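/- Let $\mathbb{D}_1^\infty=\{\zeta\in\ell^1:\ |\zeta_n|<1\text{ for all }n\ge 1\}$, a domain in the complex Banach space $\ell^1$, and let $m_\infty$ be the normalized Haar measure on the infinite torus $\mathbb{T}^\infty$. A function $F:\mathbb{D}_1^\infty\to\mathbb{C}$ is holomorphic if it is locally bounded and $z\mapsto F(\zeta+z\xi)$ is holomorphic on $\{z\in\mathbb{C}:\zeta+z\xi\in\mathbb{D}_1^\infty\}$ for all $\zeta\in\mathbb{D}_1^\infty$, $\xi\in\ell^1$. For $0<r<1$ and $w\in\mathbb{T}^\infty$ put $F_{[r]}(w)=F(rw_1,r^2w_2,\ldots,r^nw_n,\ldots)$. The Nevanlinna class $N(\mathbb{D}_1^\infty)$ consists of all holomorphic functions $F$ on $\mathbb{D}_1^\infty$ with $\sup_{0<r<1}\int_{\mathbb{T}^\infty}\log^+|F_{[r]}|\,dm_\infty<\infty$, and the Smirnov class $N_*(\mathbb{D}_1^\infty)$ of all $F\in N(\mathbb{D}_1^\infty)$ for which the family $\{\log^+|F_{[r]}|\}_{0<r<1}$ is uniformly integrable with respect to $m_\infty$. For $\zeta\in\mathbb{D}_1^\infty$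 let $$\mathbf{P}_\zeta(w)=\prod_{n=1}^\infty\frac{1-|\zeta_n|^2}{|\zeta_n-w_n|^2},\qquad w\in\mathbb{T}^\infty.$$ **Proposition.** Suppose that $F\in N(\mathbb{D}_1^\infty)$. Then the radial limit $F^*(w)=\lim_{r\to1^-}F_{[r]}(w)$ exists for almost every $w\in\mathbb{T}^\infty$, and $F\in N_*(\mathbb{D}_1^\infty)$ if and only if for every $\zeta\in\mathbb{D}_1^\infty$, $$\log|F(\zeta)|\le\int_{\mathbb{T}^\infty}\mathbf{P}_\zeta\log|F^*|\,dm_\infty .$$ Here $\log 0=-\infty$, and both sides take values in the extended reals (the integral is the integral of the positive part minus that of the negative part). -/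

import Mathlib

open MeasureTheory Filter Topology Set
open scoped ENNReal

noncomputable section

namespace InfPolydisc

/-- The complex Banach space `ℓ¹` of summable sequences. Coordinates are indexed by
`n = 0, 1, 2, …`, so that the coordinate `n` here is the `(n + 1)`-st variable. -/
abbrev Ell1 : Type := lp (fun _ : ℕ => ℂ) 1

/-- The domain of all summable sequences whose entries lie in the open unit disk. -/
def D1 : Set Ell1 := {ζ | ∀ n, ‖ζ n‖ < 1}

/-- The infinite torus, with the product topology and the coordinatewise product. -/
abbrev Torus : Type := ℕ → Circle

instance : MeasurableSpace Circle := borel Circle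

instance : BorelSpace Circle := ⟨rfl⟩

/-- The normalized Haar measure on the infinite torus. -/
def mInf : Measure Torus :=
  Measure.haarMeasure (⊤ : TopologicalSpace.PositiveCompacts Torus)

/-- Holomorphic functions on a subset `V` of a complex normed space: locally bounded, and
holomorphic along every complex line. Only the values of `F` on `V` matter. -/
def IsHolomorphicOn {X : Type*} [NormedAddCommGroup X] [NormedSpace ℂ X]
    (F : X → ℂ) (V : Set X) : Prop :=
  (∀ x ∈ V, ∃ U ∈ 𝓝 x, ∃ C : ℝ, ∀ y ∈ U ∩ V, ‖F y‖ ≤ C) ∧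
  ∀ x₀ ∈ V, ∀ x : X,
    DifferentiableOn ℂ (fun z : ℂ => F (x₀ + z • x)) {z : ℂ | x₀ + z • x ∈ V}

theorem memℓp_dilate {r : ℝ} (hr : |r| < 1) (w : Torus) :
    Memℓp (fun n : ℕ => ((r : ℂ) ^ (n + 1) * (w n : ℂ) : ℂ)) 1 := by
  refine memℓp_gen ?_
  have h : Summable fun n : ℕ => |r| ^ (n + 1) :=
    (summable_nat_add_iff 1).2 (summable_geometric_of_lt_one (abs_nonneg r) hr)
  refine h.congr fun n => ?_
  simp [Circle.norm_coe]

/-- The point `(r w₁, r² w₂, r³ w₃, …)` of `ℓ¹`, for `|r| < 1` (and `0` for all other `r`, which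
are never used). -/
def dilate (r : ℝ) (w : Torus) : Ell1 :=
  if h : |r| < 1 then ⟨fun n : ℕ => (r : ℂ) ^ (n + 1) * (w n : ℂ), memℓp_dilate h w⟩ else 0

theorem dilate_apply {r : ℝ} (hr : |r| < 1) (w : Torus) (n : ℕ) :
    dilate r w n = (r : ℂ) ^ (n + 1) * (w n : ℂ) := by
  simp [dilate, hr]

theorem dilate_mem_D1 {r : ℝ} (hr : |r| < 1) (w : Torus) : dilate r w ∈ D1 := by
  intro n
  rw [dilate_apply hr]
  simpa [Circle.norm_coe] using pow_lt_one₀ (abs_nonneg r) hr n.succ_ne_zero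

/-- The function `F_[r]` on the infinite torus, `F_[r](w) = F(r w₁, r² w₂, r³ w₃, …)`. -/
def slice (F : Ell1 → ℂ) (r : ℝ) (w : Torus) : ℂ := F (dilate r w)

/-- The Nevanlinna class: holomorphic functions on `D1` for which the integrals of
`log⁺ |F_[r]|`, `0 < r < 1`, are bounded. -/
def Nevanlinna (F : Ell1 → ℂ) : Prop :=
  IsHolomorphicOn F D1 ∧
  (⨆ r ∈ Ioo (0 : ℝ) 1, ∫⁻ w, ENNReal.ofReal (Real.posLog ‖slice F r w‖) ∂mInf) < ∞

/-- The Smirnov class: functions in the Nevanlinna class for which the family `log⁺ |F_[r]|`,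
`0 < r < 1`, is uniformly integrable. -/
def Smirnov (F : Ell1 → ℂ) : Prop :=
  Nevanlinna F ∧
  UniformIntegrable (fun (r : Ioo (0 : ℝ) 1) (w : Torus) => Real.posLog ‖slice F r w‖) 1 mInf

/-- The radial limit `F*(w) = lim_{r → 1⁻} F_[r](w)`. -/
def radialLimit (F : Ell1 → ℂ) (w : Torus) : ℂ :=
  limUnder (𝓝[<] (1 : ℝ)) fun r => slice F r w

/-- The Poisson kernel `∏ₙ (1 - |ζₙ|²) / |ζₙ - wₙ|²` at `ζ`. (Each `wₙ` has modulus `1`, so the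
factors are Mathlib's Poisson kernels of the unit disk.) -/
def poisson (ζ : Ell1) (w : Torus) : ℝ :=
  ∏' n, poissonKernel 0 (ζ n) (w n : ℂ)

/-- `log |z|` with values in `[-∞, ∞)`; `log |0| = -∞`. -/
def logAbs (z : ℂ) : EReal := ENNReal.log ‖z‖ₑ

/-- The integral of an extended-real-valued function: the integral of the positive part minus
the integral of the negative part. -/
def eintegral {α : Type*} [MeasurableSpace α] (μ : Measure α) (g : α → EReal) : EReal :=
  ((∫⁻ x, (g x).toENNReal ∂μ : ℝ≥0∞) : EReal) - ((∫⁻ x, (-g x).toENNReal ∂μ : ℝ≥0∞) : EReal)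

end InfPolydisc

end

/-! ### Means of `log⁺ |f|` and radial limits of derivatives on the disk. -/

namespace InfPolydisc

open Metric Real

/-! Radial limits. For fixed `w`, `diskFunction F w` restricts `F` to the analytic disk `z ↦ (z w₁,
z² w₂, …)`; its value at `r c` is `F_[r]` at the point `w` rotated by the powers of `c`. Haar
measure is invariant under these rotations, so Fubini turns the Nevanlinna bound into a bound for
the average over `w` of the circle means of `log⁺`. By Fatou's lemma, for almost every `w` these
circle means stay bounded along infinitely many radii of a fixed sequence tending to 1. A function
of one variable with this property is a quotient of bounded holomorphic functions
(`exists_bounded_factor`). It has radial limits almost everywhere, by Fatou's theorem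
(`ae_exists_radialLimit_of_bounded`) and because the limits of the denominator are almost everywhere
nonzero (`ae_radialLimit_ne_zero`). Rotation invariance then carries this back to the torus.

Smirnov implies the inequality. Coordinatewise disk automorphisms push Haar measure to the Poisson
measure of `ζ` (`map_mobiusTorus`), so the mean inequality on disks through the origin gives a
Poisson majorant for `log⁺ |F|` at a dilate of `ζ`, in terms of `F_[r]`. Uniform integrability and
Vitali's theorem let `r → 1`, since the Poisson kernel is bounded. To pass from `log⁺` to `log`,
apply the result to `e^K F`, using `log⁺ |e^K z| - K = max (log |z|) (-K)`, and let `K → ∞`.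

Conversely, the positive part of the inequality bounds `log⁺ |F_[r]|` by an average of translates of
the single integrable function `log⁺ |F*|`, against a probability density. Translates have the same
modulus of absolute continuity, so the family is uniformly integrable.

Continuity of `F` along infinite-dimensional families rests on `IsHolomorphicOn.differentiableAt`:
local boundedness and holomorphy on lines imply Fréchet differentiability. -/

theorem posLog_norm_le_circleAverage_of_analyticOnNhd {f : ℂ → ℂ} {R : ℝ} (hR : 0 < R)
    (hf : AnalyticOnNhd ℂ f (closedBall 0 R)) :
    posLog ‖f 0‖ ≤ circleAverage (fun z => posLog ‖f z‖) 0 R := by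
  have hcont : CircleIntegrable (fun z => posLog ‖f z‖) 0 R := by
    apply ContinuousOn.circleIntegrable hR.le
    exact continuous_posLog.comp_continuousOn
      (hf.continuousOn.mono sphere_subset_closedBall).norm
  have h0 : 0 ≤ circleAverage (fun z => posLog ‖f z‖) 0 R :=
    circleAverage_nonneg_of_nonneg fun _ _ => posLog_nonneg
  rcases eq_or_ne (f 0) 0 with h | h
  · simpa [h] using h0
  have habs : |R| = R := abs_of_pos hR
  have hJ := AnalyticOnNhd.circleAverage_log_norm hR.ne' (c := 0) (by rwa [habs]) h
  -- In Jensen's formula the mean of `log |f|` exceeds `log |f 0|` by this sum over zeros; a zero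
  -- `u` in the closed disk contributes a multiple of `log (R / |u|) ≥ 0`.
  have hpos : 0 ≤ ∑ᶠ u, ((MeromorphicOn.divisor f (closedBall 0 |R|) u : ℤ) : ℝ) *
      Real.log (R * ‖0 - u‖⁻¹) := by
    refine finsum_nonneg fun u => ?_
    by_cases hu : u ∈ closedBall (0 : ℂ) |R|
    · refine mul_nonneg ?_ ?_
      · exact_mod_cast MeromorphicOn.AnalyticOnNhd.divisor_nonneg (by rwa [habs]) u
      · rcases eq_or_ne u 0 with rfl | hu0
        -- Here the logarithm is `log (R * 0⁻¹) = log 0 = 0` by the default values.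
        · simp
        · apply Real.log_nonneg
          rw [habs, mem_closedBall, dist_zero_right] at hu
          rw [zero_sub, norm_neg, ← div_eq_mul_inv, one_le_div (norm_pos_iff.2 hu0)]
          exact hu
    · rw [Function.locallyFinsuppWithin.apply_eq_zero_of_notMem _ hu]
      simp
  have hlog : Real.log ‖f 0‖ ≤ circleAverage (fun z => posLog ‖f z‖) 0 R := by
    calc Real.log ‖f 0‖ ≤ circleAverage (fun z => Real.log ‖f z‖) 0 R := by rw [hJ]; linarith
      _ ≤ _ := by
        refine circleAverage_mono ?_ hcont fun z _ => le_max_right _ _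
        exact MeromorphicOn.circleIntegrable_log_norm
          (hf.mono (by rw [habs]; exact sphere_subset_closedBall)).meromorphicOn
  exact max_le h0 hlog

/-- Shrinking the circle reduces to functions analytic across it; uniform continuity up to the
boundary lets the radius return to 1. -/
theorem posLog_norm_le_circleAverage {f : ℂ → ℂ} (hf : DiffContOnCl ℂ f (ball 0 1)) :
    posLog ‖f 0‖ ≤ circleAverage (fun z => posLog ‖f z‖) 0 1 := by
  have hc : ContinuousOn (circleAverage (fun z => posLog ‖f z‖) 0) (Icc 0 1) := by
    apply ContinuousOn.circleAverage
    · apply continuous_posLog.comp_continuousOn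
      apply ContinuousOn.norm
      refine hf.continuousOn.mono ?_
      rw [closure_ball 0 one_ne_zero]
      intro z hz
      simpa using hz.2
    · exact fun r hr => hr.1
  have ht : Tendsto (circleAverage (fun z => posLog ‖f z‖) 0) (𝓝[<] 1)
      (𝓝 (circleAverage (fun z => posLog ‖f z‖) 0 1)) := by
    refine (hc 1 (by simp)).mono_left ?_
    rw [← nhdsWithin_Ioo_eq_nhdsLT (zero_lt_one' ℝ)]
    exact nhdsWithin_mono _ Ioo_subset_Icc_self
  refine ge_of_tendsto ht ?_
  filter_upwards [Ioo_mem_nhdsLT (zero_lt_one' ℝ)] with r hr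
  refine posLog_norm_le_circleAverage_of_analyticOnNhd hr.1 ?_
  exact (hf.differentiableOn.analyticOnNhd isOpen_ball).mono (closedBall_subset_ball hr.2)

/-- The derivative kernel `z (1 / (z - r)² - 1 / (1 - r z)²)`, which is bounded on the circle by the
Poisson kernel divided by `|z - 1|`. -/
theorem deriv_eq_circleAverage {E : ℂ → ℂ} (hE : DiffContOnCl ℂ E (ball 0 1)) {r : ℝ}
    (h0 : 0 < r) (h1 : r < 1) :
    deriv E r = circleAverage (fun z => (z / (z - r) ^ 2 - z / (1 - r * z) ^ 2) * E z) 0 1 := by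
  have hr : (r : ℂ) ∈ ball (0 : ℂ) 1 := by simp [abs_of_pos h0, h1]
  have hcs : ContinuousOn E (sphere 0 1) := by
    refine hE.continuousOn.mono ?_
    rw [closure_ball 0 one_ne_zero]
    exact sphere_subset_closedBall
  have hint : CircleIntegrable E 0 1 := hcs.circleIntegrable zero_le_one
  have hne : ∀ w ∈ ball (0 : ℂ) 1, ∀ z ∈ sphere (0 : ℂ) 1, z - w ≠ 0 := by
    intro w hw z hz h
    rw [sub_eq_zero] at h
    subst h
    simp at hw hz
    linarith
  have hne2 : ∀ z ∈ closedBall (0 : ℂ) 1, 1 - (r : ℂ) * z ≠ 0 := by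
    intro z hz h
    have : ‖(r : ℂ) * z‖ = 1 := by rw [← sub_eq_zero.1 h]; simp
    rw [norm_mul, Complex.norm_real, Real.norm_eq_abs, abs_of_pos h0] at this
    simp at hz
    nlinarith
  -- the Herglotz transform of `E`
  have hH : ∀ w ∈ ball (0 : ℂ) 1,
      circleAverage (fun ζ => herglotzRieszKernel 0 w ζ • E ζ) 0 1 = 2 * E w - E 0 := by
    intro w hw
    -- The Herglotz kernel is `2 z / (z - w) - 1`, so Cauchy's formula and the mean value property
    -- evaluate the transform.
    have e1 := DiffContOnCl.circleAverage_smul_div (f := E) (c := 0) (R := 1) (w := w)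
      (by simpa using hE) (by simpa using hw)
    have e2 := DiffContOnCl.circleAverage (f := E) (c := 0) (R := 1) (by simpa using hE)
    rw [← e1, ← e2]
    have : (2 : ℂ) * circleAverage (fun z => ((z - 0) / (z - w)) • E z) 0 1 =
        circleAverage (fun z => (2 : ℂ) • ((z - 0) / (z - w)) • E z) 0 1 := by
      rw [circleAverage_fun_smul]; rfl
    rw [this, ← circleAverage_fun_sub]
    · refine circleAverage_congr_sphere fun z hz => ?_
      have := hne w hw z (by simpa using hz)
      simp only [herglotzRieszKernel_def, sub_zero, smul_eq_mul]
      field_simp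
      ring
    · apply ContinuousOn.circleIntegrable zero_le_one
      have := hne w hw
      fun_prop (disch := assumption)
    · exact hint
  have hd := hasDerivAt_circleAverage_herglotzRieszKernel_smul hint hr
  have hd2 : HasDerivAt (fun w => 2 * E w - E 0) (2 * deriv E r) (r : ℂ) := by
    have := (hE.differentiableAt isOpen_ball hr).hasDerivAt
    exact (this.const_mul 2).sub_const _
  have hd3 := hd.congr_of_eventuallyEq (f₁ := fun w => 2 * E w - E 0) (by
    filter_upwards [isOpen_ball.mem_nhds hr] with w hw
    exact (hH w hw).symm)
  have key := hd2.unique hd3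
  -- The second kernel is holomorphic in the disk and vanishes at the origin, so it integrates to
  -- zero. Subtracting it costs nothing and makes the full kernel small near `z = 1`.
  have hz : circleAverage (fun z => z / (1 - r * z) ^ 2 * E z) 0 1 = 0 := by
    have := DiffContOnCl.circleAverage (f := fun z => z / (1 - r * z) ^ 2 * E z) (c := 0) (R := 1)
      (by
        rw [abs_one]
        refine DiffContOnCl.smul (f := E) (c := fun z : ℂ => z / (1 - r * z) ^ 2) ?_ hE
        apply DifferentiableOn.diffContOnCl
        rw [closure_ball 0 one_ne_zero]
        intro z hz
        have := pow_ne_zero 2 (hne2 z hz)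
        exact DifferentiableAt.differentiableWithinAt (by fun_prop (disch := assumption)))
    simpa using this
  have hsub : circleAverage (fun z => (z / (z - r) ^ 2 - z / (1 - r * z) ^ 2) * E z) 0 1 =
      circleAverage (fun z => z / (z - r) ^ 2 * E z) 0 1 -
        circleAverage (fun z => z / (1 - r * z) ^ 2 * E z) 0 1 := by
    rw [← circleAverage_fun_sub]
    · simp only [sub_mul]
    · apply ContinuousOn.circleIntegrable zero_le_one
      have : ∀ z ∈ sphere (0 : ℂ) 1, (z - r) ^ 2 ≠ 0 := fun z hz => pow_ne_zero 2 (hne r hr z hz)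
      fun_prop (disch := assumption)
    · apply ContinuousOn.circleIntegrable zero_le_one
      have : ∀ z ∈ sphere (0 : ℂ) 1, (1 - r * z) ^ 2 ≠ 0 :=
        fun z hz => pow_ne_zero 2 (hne2 z (sphere_subset_closedBall hz))
      fun_prop (disch := assumption)
  rw [hsub, hz, sub_zero]
  have h2 : circleAverage (fun ζ => (2 * ζ / (ζ - r) ^ 2) • E ζ) 0 1 =
      2 * circleAverage (fun z => z / (z - r) ^ 2 * E z) 0 1 := by
    rw [← smul_eq_mul (2 : ℂ), ← circleAverage_fun_smul]
    congr 1
    ext z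
    simp only [smul_eq_mul]
    ring
  rw [h2] at key
  exact mul_left_cancel₀ two_ne_zero key

theorem continuousOn_poissonKernel_sphere {a : ℂ} (ha : ‖a‖ < 1) :
    ContinuousOn (poissonKernel 0 a) (sphere 0 1) := by
  have : ∀ z ∈ sphere (0 : ℂ) 1, ‖(z - 0) - (a - 0)‖ ^ 2 ≠ 0 := by
    intro z hz h
    have h2 : z = a := by simpa [sub_eq_zero] using h
    subst h2
    simp at hz
    linarith
  unfold poissonKernel
  fun_prop (disch := assumption)

theorem circleAverage_poissonKernel {a : ℂ} (ha : ‖a‖ < 1) :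
    circleAverage (poissonKernel 0 a) 0 1 = 1 := by
  have h1 := DiffContOnCl.circleAverage_poissonKernel_smul (f := fun _ : ℂ => (1 : ℂ))
    (c := 0) (R := 1) (w := a) diffContOnCl_const (by simpa using ha)
  have h2 : (poissonKernel 0 a • fun _ : ℂ => (1 : ℂ)) = Complex.ofRealCLM ∘ poissonKernel 0 a := by
    ext z; simp
  rw [h2, ContinuousLinearMap.circleAverage_comp_comm _
    ((continuousOn_poissonKernel_sphere ha).circleIntegrable zero_le_one)] at h1
  rw [Complex.ofRealCLM_apply] at h1
  exact_mod_cast h1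

theorem norm_one_sub_mul_eq {r : ℝ} {z : ℂ} (hz : ‖z‖ = 1) : ‖1 - r * z‖ = ‖z - r‖ := by
  have h : (1 - r * z) = z * (starRingEnd ℂ) (z - r) := by
    have : z * (starRingEnd ℂ) z = 1 := by
      rw [Complex.mul_conj, Complex.normSq_eq_norm_sq, hz]; simp
    rw [map_sub, mul_sub, this, Complex.conj_ofReal]
    ring
  rw [h, norm_mul, hz, one_mul, RCLike.norm_conj]

/-- The difference of squares `(1 - r z)² - (z - r)²` factors as `(1 - r²)(1 - z)(1 + z)`, and `|1 -
r z| = |z - r|` on the circle. -/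
theorem norm_deriv_kernel_mul {r : ℝ} (h0 : 0 < r) (h1 : r < 1) {z : ℂ} (hz : ‖z‖ = 1) :
    ‖z / (z - r) ^ 2 - z / (1 - r * z) ^ 2‖ * ‖z - r‖ ^ 4 =
      (1 - r ^ 2) * (‖z + 1‖ * ‖z - 1‖) := by
  have hn1 : z - r ≠ 0 := by
    intro h
    rw [sub_eq_zero] at h
    rw [h, Complex.norm_real, Real.norm_eq_abs, abs_of_pos h0] at hz
    linarith
  have hn2 : 1 - r * z ≠ 0 := by
    rw [← norm_ne_zero_iff, norm_one_sub_mul_eq hz, norm_ne_zero_iff]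
    exact hn1
  have e : (z / (z - r) ^ 2 - z / (1 - r * z) ^ 2) * ((z - r) ^ 2 * (1 - r * z) ^ 2) =
      z * ((1 - (r : ℂ) ^ 2) * ((z + 1) * (1 - z))) := by
    have h3 : z / (z - r) ^ 2 * ((z - r) ^ 2 * (1 - r * z) ^ 2) = z * (1 - r * z) ^ 2 := by
      rw [← mul_assoc, div_mul_cancel₀ _ (pow_ne_zero 2 hn1)]
    have h4 : z / (1 - r * z) ^ 2 * ((z - r) ^ 2 * (1 - r * z) ^ 2) = z * (z - r) ^ 2 := by
      rw [mul_comm ((z - r) ^ 2), ← mul_assoc, div_mul_cancel₀ _ (pow_ne_zero 2 hn2)]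
    rw [sub_mul, h3, h4]
    ring
  have e2 := congrArg norm e
  rw [norm_mul, norm_mul, norm_mul, norm_mul, norm_mul, norm_pow, norm_pow,
    norm_one_sub_mul_eq hz, hz, one_mul, norm_sub_rev 1 z] at e2
  have e3 : ‖(1 - (r : ℂ) ^ 2)‖ = 1 - r ^ 2 := by
    have : (1 - (r : ℂ) ^ 2) = ((1 - r ^ 2 : ℝ) : ℂ) := by push_cast; ring
    rw [this, Complex.norm_real, Real.norm_eq_abs, abs_of_nonneg]
    nlinarith
  rw [e3] at e2
  rw [← e2]
  ring

theorem norm_sub_one_le_two_mul {r : ℝ} (h0 : 0 < r) (h1 : r < 1) {z : ℂ} (hz : ‖z‖ = 1) :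
    ‖z - 1‖ ≤ 2 * ‖z - r‖ := by
  have ha : ‖(r : ℂ)‖ = r := by rw [Complex.norm_real, Real.norm_eq_abs, abs_of_pos h0]
  have hb : ‖z‖ - ‖(r : ℂ)‖ ≤ ‖z - r‖ := norm_sub_norm_le _ _
  have hc : ‖z - 1‖ ≤ ‖z - r‖ + ‖(r : ℂ) - 1‖ := by
    simpa using norm_sub_le_norm_sub_add_norm_sub z (r : ℂ) 1
  have hd : ‖(r : ℂ) - 1‖ = 1 - r := by
    rw [← Complex.ofReal_one, ← Complex.ofReal_sub, Complex.norm_real, Real.norm_eq_abs,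
      abs_of_neg (by linarith)]
    ring
  rw [ha, hz] at hb
  linarith

/-- If a function on the closed disk, holomorphic inside, has a derivative at the point `1`
along the circle, then its complex derivative has that radial limit at `1`. -/
theorem tendsto_deriv_of_isLittleO {E : ℂ → ℂ} (hE : DiffContOnCl ℂ E (ball 0 1))
    (ho : ∀ ε > 0, ∃ η > 0, ∀ z : ℂ, ‖z‖ = 1 → ‖z - 1‖ < η → ‖E z‖ ≤ ε * ‖z - 1‖) :
    Tendsto (fun r : ℝ => deriv E r) (𝓝[<] 1) (𝓝 0) := by
  have hcs : ContinuousOn E (sphere 0 1) := by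
    refine hE.continuousOn.mono ?_
    rw [closure_ball 0 one_ne_zero]
    exact sphere_subset_closedBall
  obtain ⟨B, hB⟩ := (isCompact_sphere (0 : ℂ) 1).exists_bound_of_continuousOn hcs
  have hB0 : 0 ≤ B := (norm_nonneg _).trans (hB 1 (by simp))
  have main : ∀ ε > 0, ∃ C : ℝ, ∀ r : ℝ, 0 < r → r < 1 →
      ‖deriv E r‖ ≤ 8 * ε + C * (1 - r ^ 2) := by
    intro ε hε
    obtain ⟨η, hη, hη'⟩ := ho ε hε
    -- This constant serves the arc `|z - 1| ≥ η`: `|z + 1|` and `|z - 1|` are at most 2, `|E| ≤ B`,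
    -- and `|z - r| ≥ η / 2`. On the other arc, one factor 2 from `|z + 1|` and two from `|z - 1| ≤
    -- 2 |z - r|` give `8 ε` times the Poisson kernel, whose mean is 1.
    refine ⟨2 * 2 * B * (2 / η) ^ 4, fun r h0 h1 => ?_⟩
    have hr : ‖(r : ℂ)‖ < 1 := by rwa [Complex.norm_real, Real.norm_eq_abs, abs_of_pos h0]
    have hr2 : 0 ≤ 1 - r ^ 2 := by nlinarith
    have hPint := (continuousOn_poissonKernel_sphere hr).circleIntegrable zero_le_one
    have hpt : ∀ z ∈ sphere (0 : ℂ) 1,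
        ‖(z / (z - r) ^ 2 - z / (1 - r * z) ^ 2) * E z‖ ≤
          (8 * ε) * poissonKernel 0 r z + 2 * 2 * B * (2 / η) ^ 4 * (1 - r ^ 2) := by
      intro z hz
      have hz1 : ‖z‖ = 1 := by simpa using hz
      have k1 := norm_deriv_kernel_mul h0 h1 hz1
      have k2 := norm_sub_one_le_two_mul h0 h1 hz1
      have hpos : 0 < ‖z - r‖ := by
        have : ‖z‖ - ‖(r : ℂ)‖ ≤ ‖z - r‖ := norm_sub_norm_le _ _
        linarith
      have hz2 : ‖z + 1‖ ≤ 2 := (norm_add_le _ _).trans (by rw [hz1]; norm_num)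
      have hz3 : ‖z - 1‖ ≤ 2 := (norm_sub_le _ _).trans (by rw [hz1]; norm_num)
      have hP : poissonKernel 0 r z = (1 - r ^ 2) / ‖z - r‖ ^ 2 := by
        rw [poissonKernel_def]
        simp [hz1]
      have hP0 : 0 ≤ poissonKernel 0 r z := by rw [hP]; positivity
      rw [norm_mul]
      set K := ‖z / (z - r) ^ 2 - z / (1 - r * z) ^ 2‖
      have hK : K = (1 - r ^ 2) * (‖z + 1‖ * ‖z - 1‖) / ‖z - r‖ ^ 4 := by
        rw [← k1]; field_simp
      rcases lt_or_ge ‖z - 1‖ η with h | h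
      · have hEz := hη' z hz1 h
        have : K * ‖E z‖ ≤ 8 * ε * poissonKernel 0 r z := by
          rw [hK, hP]
          calc (1 - r ^ 2) * (‖z + 1‖ * ‖z - 1‖) / ‖z - r‖ ^ 4 * ‖E z‖
              ≤ (1 - r ^ 2) * (2 * (2 * ‖z - r‖)) / ‖z - r‖ ^ 4 * (ε * (2 * ‖z - r‖)) := by
                gcongr
                exact hEz.trans (by gcongr)
            _ = 8 * ε * ((1 - r ^ 2) / ‖z - r‖ ^ 2) := by field_simp; ring
        have : 0 ≤ 2 * 2 * B * (2 / η) ^ 4 * (1 - r ^ 2) := by positivity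
        linarith
      · have : K * ‖E z‖ ≤ 2 * 2 * B * (2 / η) ^ 4 * (1 - r ^ 2) := by
          have hinv : 1 / ‖z - r‖ ≤ 2 / η := by
            rw [div_le_div_iff₀ hpos hη]; linarith
          calc K * ‖E z‖ = (1 - r ^ 2) * (‖z + 1‖ * ‖z - 1‖) * (1 / ‖z - r‖) ^ 4 * ‖E z‖ := by
                rw [hK]; field_simp
            _ ≤ (1 - r ^ 2) * (2 * 2) * (2 / η) ^ 4 * B := by
                gcongr
                exact hB z hz
            _ = _ := by ring
        have : 0 ≤ 8 * ε * poissonKernel 0 r z := by positivity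
        linarith
    rw [deriv_eq_circleAverage hE h0 h1]
    have hne : ∀ z ∈ sphere (0 : ℂ) 1, (z - r) ^ 2 ≠ 0 := by
      intro z hz h
      have hz1 : ‖z‖ = 1 := by simpa using hz
      rw [pow_eq_zero_iff two_ne_zero, sub_eq_zero] at h
      rw [h] at hz1
      linarith
    have hne2 : ∀ z ∈ sphere (0 : ℂ) 1, (1 - r * z) ^ 2 ≠ 0 := by
      intro z hz h
      have hz1 : ‖z‖ = 1 := by simpa using hz
      rw [pow_eq_zero_iff two_ne_zero, ← norm_eq_zero, norm_one_sub_mul_eq hz1, norm_eq_zero] at h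
      exact hne z hz (by rw [h]; simp)
    calc ‖circleAverage (fun z => (z / (z - r) ^ 2 - z / (1 - r * z) ^ 2) * E z) 0 1‖
        ≤ circleAverage (fun z => ‖(z / (z - r) ^ 2 - z / (1 - r * z) ^ 2) * E z‖) 0 1 := by
          rw [circleAverage_def, circleAverage_def, norm_smul, smul_eq_mul, Real.norm_eq_abs,
            abs_of_pos (by positivity)]
          gcongr
          exact intervalIntegral.norm_integral_le_integral_norm two_pi_pos.le
      _ ≤ circleAverage (fun z => (8 * ε) * poissonKernel 0 r z +
            2 * 2 * B * (2 / η) ^ 4 * (1 - r ^ 2)) 0 1 := by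
          refine circleAverage_mono ?_ ?_ (by simpa using hpt)
          · apply ContinuousOn.circleIntegrable zero_le_one
            fun_prop (disch := assumption)
          · apply ContinuousOn.circleIntegrable zero_le_one
            have := continuousOn_poissonKernel_sphere hr
            fun_prop
      _ = 8 * ε + 2 * 2 * B * (2 / η) ^ 4 * (1 - r ^ 2) := by
          rw [circleAverage_fun_add, circleAverage_const]
          · have : circleAverage (fun z => 8 * ε * poissonKernel 0 r z) 0 1 =
                8 * ε * circleAverage (poissonKernel 0 r) 0 1 := by
              rw [← smul_eq_mul (8 * ε), ← circleAverage_fun_smul]; rfl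
            rw [this, circleAverage_poissonKernel hr, mul_one]
          · apply ContinuousOn.circleIntegrable zero_le_one
            have := continuousOn_poissonKernel_sphere hr
            fun_prop
          · exact continuousOn_const.circleIntegrable zero_le_one
  rw [Metric.tendsto_nhds]
  intro δ hδ
  obtain ⟨C, hC⟩ := main (δ / 16) (by positivity)
  have ht : Tendsto (fun r : ℝ => 8 * (δ / 16) + C * (1 - r ^ 2)) (𝓝[<] 1) (𝓝 (δ / 2)) := by
    have : Tendsto (fun r : ℝ => 8 * (δ / 16) + C * (1 - r ^ 2)) (𝓝 1)
        (𝓝 (8 * (δ / 16) + C * (1 - 1 ^ 2))) := by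
      apply Continuous.tendsto; fun_prop
    convert this.mono_left nhdsWithin_le_nhds using 2
    ring
  filter_upwards [ht.eventually (gt_mem_nhds (half_lt_self hδ)),
    Ioo_mem_nhdsLT (zero_lt_one' ℝ)] with r hr hr'
  rw [dist_zero_right]
  exact (hC r hr'.1 hr'.2).trans_lt hr

end InfPolydisc

/-! ### Arc length, disk automorphisms and the Poisson kernel. -/

namespace InfPolydisc

open Metric Real
open scoped ComplexConjugate

/-- The normalized arc length measure on the unit circle. -/
noncomputable def circleMeasure : Measure Circle :=
  (ENNReal.ofReal (2 * π)⁻¹ • volume.restrict (Ioc 0 (2 * π))).map Circle.exp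

theorem continuous_coe_circle : Continuous fun c : Circle => (c : ℂ) := continuous_induced_dom

theorem coe_circle_mem_sphere (c : Circle) : (c : ℂ) ∈ sphere (0 : ℂ) 1 :=
  mem_sphere_zero_iff_norm.2 c.norm_coe

theorem integral_circleMeasure {E : Type*} [NormedAddCommGroup E] [NormedSpace ℝ E]
    {f : ℂ → E} (hf : ContinuousOn f (sphere 0 1)) :
    ∫ c : Circle, f c ∂circleMeasure = circleAverage f 0 1 := by
  have hc : Continuous fun c : Circle => f c :=
    hf.comp_continuous continuous_coe_circle coe_circle_mem_sphere
  rw [circleMeasure, integral_map Circle.exp.continuous.aemeasurable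
    (hc.stronglyMeasurable_of_hasCompactSupport
      (HasCompactSupport.of_compactSpace _)).aestronglyMeasurable]
  rw [integral_smul_measure, circleAverage_def, intervalIntegral.integral_of_le two_pi_pos.le,
    ENNReal.toReal_ofReal (by positivity)]
  congr 2
  ext θ
  simp [circleMap]

instance : IsProbabilityMeasure circleMeasure := by
  unfold circleMeasure
  have : IsProbabilityMeasure
      (ENNReal.ofReal (2 * π)⁻¹ • volume.restrict (Ioc 0 (2 * π)) : Measure ℝ) := by
    constructor
    rw [Measure.smul_apply, Measure.restrict_apply_univ, Real.volume_Ioc, smul_eq_mul,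
      ← ENNReal.ofReal_mul (by positivity)]
    rw [sub_zero, inv_mul_cancel₀ two_pi_pos.ne', ENNReal.ofReal_one]
  exact Measure.isProbabilityMeasure_map Circle.exp.continuous.aemeasurable

/-- A finite measure on the circle is determined by its Fourier coefficients. -/
theorem circle_measure_ext {μ ν : Measure Circle} [IsFiniteMeasure μ] [IsFiniteMeasure ν]
    (h : ∀ n : ℕ, ∫ c : Circle, (c : ℂ) ^ n ∂μ = ∫ c : Circle, (c : ℂ) ^ n ∂ν) : μ = ν := by
  have hint : ∀ (μ : Measure Circle) [IsFiniteMeasure μ] (g : C(Circle, ℂ)), Integrable g μ :=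
    fun μ _ g => g.continuous.integrable_of_hasCompactSupport (HasCompactSupport.of_compactSpace _)
  -- On the circle negative powers are conjugates of positive ones, and the measures are positive,
  -- so nonnegative exponents suffice.
  have hz : ∀ n : ℤ, ∫ c : Circle, (c : ℂ) ^ n ∂μ = ∫ c : Circle, (c : ℂ) ^ n ∂ν := by
    intro n
    obtain ⟨k, rfl | rfl⟩ := n.eq_nat_or_neg
    · simpa using h k
    · have e : ∀ c : Circle, (c : ℂ) ^ (-(k : ℤ)) = conj ((c : ℂ) ^ k) := by
        intro c
        rw [zpow_neg, zpow_natCast, map_pow, ← Circle.coe_inv_eq_conj, Circle.coe_inv, inv_pow]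
      simp_rw [e, integral_conj, h k]
  have hfact : Fact (0 < 2 * π) := ⟨two_pi_pos⟩
  let e := AddCircle.homeomorphCircle'
  have hspan : ∀ f ∈ Submodule.span ℂ (range (@fourier (2 * π))),
      ∫ c, f (e.symm c) ∂μ = ∫ c, f (e.symm c) ∂ν := by
    intro f hf
    induction hf using Submodule.span_induction with
    | mem f hf =>
      obtain ⟨n, rfl⟩ := hf
      have : ∀ c, fourier n (e.symm c) = (c : ℂ) ^ n := by
        intro c
        obtain ⟨x, rfl⟩ := e.surjective c
        rw [e.symm_apply_apply, fourier_apply, AddCircle.toCircle_zsmul, Circle.coe_zpow]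
        obtain ⟨x, rfl⟩ := QuotientAddGroup.mk_surjective x
        have h1 : AddCircle.toCircle (x : AddCircle (2 * π)) = Circle.exp x := by
          rw [AddCircle.toCircle_apply_mk, div_self two_pi_pos.ne', one_mul]
        exact congrArg (fun c : Circle => (c : ℂ) ^ n) h1
      simp_rw [this]
      exact hz n
    | zero => simp
    | add f g _ _ hf hg =>
      have h1 : ∀ (μ : Measure Circle) [IsFiniteMeasure μ] (f : C(AddCircle (2 * π), ℂ)),
          Integrable (fun c => f (e.symm c)) μ := fun μ _ f => hint μ (f.comp ⟨_, e.symm.continuous⟩)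
      simp only [ContinuousMap.add_apply]
      rw [integral_add (h1 μ f) (h1 μ g), integral_add (h1 ν f) (h1 ν g), hf, hg]
    | smul a f _ hf =>
      simp only [ContinuousMap.smul_apply]
      rw [integral_smul, integral_smul, hf]
  -- Equality of the two integrals is a closed condition in the uniform norm, and trigonometric
  -- polynomials are dense.
  have hall : ∀ f : C(AddCircle (2 * π), ℂ), ∫ c, f (e.symm c) ∂μ = ∫ c, f (e.symm c) ∂ν := by
    intro f
    have hcl : IsClosed {f : C(AddCircle (2 * π), ℂ) |
        ∫ c, f (e.symm c) ∂μ = ∫ c, f (e.symm c) ∂ν} := by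
      have hcont : ∀ (μ : Measure Circle) [IsFiniteMeasure μ],
          Continuous fun f : C(AddCircle (2 * π), ℂ) => ∫ c, f (e.symm c) ∂μ := by
        intro μ _
        refine continuous_iff_continuousAt.2 fun f₀ => ?_
        refine continuousAt_of_dominated (bound := fun _ => ‖f₀‖ + 1) ?_ ?_ ?_ ?_
        · exact .of_forall fun f => (hint μ (f.comp ⟨_, e.symm.continuous⟩)).aestronglyMeasurable
        · filter_upwards [Metric.ball_mem_nhds f₀ one_pos] with f hf
          refine .of_forall fun c => ?_
          have : ‖f‖ ≤ ‖f₀‖ + ‖f - f₀‖ := by simpa using norm_add_le f₀ (f - f₀)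
          rw [mem_ball, dist_eq_norm] at hf
          exact (f.norm_coe_le_norm _).trans (by linarith)
        · exact integrable_const _
        · exact .of_forall fun c => (continuous_eval_const (e.symm c)).continuousAt
      exact isClosed_eq (hcont μ) (hcont ν)
    have hf : f ∈ (Submodule.span ℂ (range (@fourier (2 * π)))).topologicalClosure := by
      rw [span_fourier_closure_eq_top]; trivial
    exact hcl.closure_subset_iff.2 hspan hf
  refine ext_of_forall_integral_eq_of_IsFiniteMeasure fun f => ?_
  have := hall ((⟨fun x => ((f x : ℝ) : ℂ), by fun_prop⟩ : C(Circle, ℂ)).comp ⟨_, e.continuous⟩)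
  simp only [ContinuousMap.comp_apply, ContinuousMap.coe_mk, e.apply_symm_apply] at this
  rw [integral_complex_ofReal, integral_complex_ofReal] at this
  exact_mod_cast this

theorem integral_pow_circleMeasure (n : ℕ) :
    ∫ c : Circle, (c : ℂ) ^ n ∂circleMeasure = 0 ^ n := by
  rw [integral_circleMeasure (f := fun z : ℂ => z ^ n) (by fun_prop)]
  have hd : Differentiable ℂ fun z : ℂ => z ^ n := by fun_prop
  exact DiffContOnCl.circleAverage (f := fun z : ℂ => z ^ n) hd.diffContOnCl

/-- Rotation by `c` multiplies the `n`-th Fourier coefficient by `c ^ n`, and that coefficient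
vanishes unless `n = 0`. -/
theorem map_mul_left_circleMeasure (c : Circle) :
    circleMeasure.map (fun x => c * x) = circleMeasure := by
  have := Measure.isProbabilityMeasure_map (μ := circleMeasure)
    (continuous_const_mul c).aemeasurable
  refine circle_measure_ext fun n => ?_
  rw [integral_map (continuous_const_mul c).aemeasurable]
  · simp only [Circle.coe_mul, mul_pow]
    rw [integral_const_mul, integral_pow_circleMeasure]
    rcases n with _ | n <;> simp
  · exact Continuous.aestronglyMeasurable (f := fun c : Circle => (c : ℂ) ^ n) (by fun_prop)

/-- The disk automorphism `z ↦ (z + a) / (1 + ā z)`. -/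
noncomputable def mobius (a z : ℂ) : ℂ := (z + a) / (1 + conj a * z)

theorem one_add_conj_mul_ne_zero {a z : ℂ} (ha : ‖a‖ < 1) (hz : ‖z‖ ≤ 1) :
    1 + conj a * z ≠ 0 := by
  intro h
  have h1 : ‖conj a * z‖ = 1 := by rw [eq_neg_of_add_eq_zero_right h]; simp
  rw [norm_mul, RCLike.norm_conj] at h1
  nlinarith [norm_nonneg a, norm_nonneg z]

theorem mobius_zero (a : ℂ) : mobius a 0 = a := by simp [mobius]

/-- The open disk, the closed disk and the circle are each preserved: all three facts are read off
the sign of the right-hand side. -/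
theorem norm_sq_mobius {a z : ℂ} (ha : ‖a‖ < 1) (hz : ‖z‖ ≤ 1) :
    1 - ‖mobius a z‖ ^ 2 = (1 - ‖a‖ ^ 2) * (1 - ‖z‖ ^ 2) / ‖1 + conj a * z‖ ^ 2 := by
  have h : ‖1 + conj a * z‖ ^ 2 ≠ 0 :=
    pow_ne_zero 2 (norm_ne_zero_iff.2 (one_add_conj_mul_ne_zero ha hz))
  rw [mobius, norm_div, div_pow, eq_div_iff h, sub_mul, div_mul_cancel₀ _ h, one_mul,
    ← Complex.normSq_eq_norm_sq, ← Complex.normSq_eq_norm_sq, ← Complex.normSq_eq_norm_sq,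
    ← Complex.normSq_eq_norm_sq]
  simp only [Complex.normSq_apply, Complex.add_re, Complex.add_im, Complex.mul_re, Complex.mul_im,
    Complex.one_re, Complex.one_im, Complex.conj_re, Complex.conj_im]
  ring

theorem norm_mobius_le_one {a z : ℂ} (ha : ‖a‖ < 1) (hz : ‖z‖ ≤ 1) : ‖mobius a z‖ ≤ 1 := by
  have h := norm_sq_mobius ha hz
  have h2 : 0 ≤ (1 - ‖a‖ ^ 2) * (1 - ‖z‖ ^ 2) / ‖1 + conj a * z‖ ^ 2 := by
    have : 0 ≤ 1 - ‖a‖ ^ 2 := by nlinarith [norm_nonneg a]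
    have : 0 ≤ 1 - ‖z‖ ^ 2 := by nlinarith [norm_nonneg z]
    positivity
  nlinarith [norm_nonneg (mobius a z)]

theorem norm_mobius_lt_one {a z : ℂ} (ha : ‖a‖ < 1) (hz : ‖z‖ < 1) : ‖mobius a z‖ < 1 := by
  have h := norm_sq_mobius ha hz.le
  have h2 : 0 < (1 - ‖a‖ ^ 2) * (1 - ‖z‖ ^ 2) / ‖1 + conj a * z‖ ^ 2 := by
    have : 0 < 1 - ‖a‖ ^ 2 := by nlinarith [norm_nonneg a]
    have : 0 < 1 - ‖z‖ ^ 2 := by nlinarith [norm_nonneg z]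
    have := norm_pos_iff.2 (one_add_conj_mul_ne_zero ha hz.le)
    positivity
  nlinarith [norm_nonneg (mobius a z)]

theorem norm_mobius_eq_one {a z : ℂ} (ha : ‖a‖ < 1) (hz : ‖z‖ = 1) : ‖mobius a z‖ = 1 := by
  have h := norm_sq_mobius ha hz.le
  rw [hz] at h
  have h2 : ‖mobius a z‖ ^ 2 = 1 := by
    rw [one_pow, sub_self, mul_zero, zero_div] at h
    linarith
  exact (pow_eq_one_iff_of_nonneg (norm_nonneg _) two_ne_zero).1 h2

theorem differentiableOn_mobius {a : ℂ} (ha : ‖a‖ < 1) :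
    DifferentiableOn ℂ (mobius a) (closedBall 0 1) := by
  intro z hz
  have := one_add_conj_mul_ne_zero ha (by simpa using hz)
  unfold mobius
  exact DifferentiableAt.differentiableWithinAt (by fun_prop (disch := assumption))

theorem diffContOnCl_mobius {a : ℂ} (ha : ‖a‖ < 1) : DiffContOnCl ℂ (mobius a) (ball 0 1) := by
  apply DifferentiableOn.diffContOnCl
  rw [closure_ball 0 one_ne_zero]
  exact differentiableOn_mobius ha

/-- The action of a disk automorphism on the unit circle. -/
noncomputable def mobiusCircle {a : ℂ} (ha : ‖a‖ < 1) (c : Circle) : Circle :=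
  ⟨mobius a c, by simpa [Submonoid.unitSphere] using norm_mobius_eq_one ha c.norm_coe⟩

theorem coe_mobiusCircle {a : ℂ} (ha : ‖a‖ < 1) (c : Circle) :
    (mobiusCircle ha c : ℂ) = mobius a c := rfl

theorem continuous_mobiusCircle {a : ℂ} (ha : ‖a‖ < 1) : Continuous (mobiusCircle ha) := by
  refine continuous_induced_rng.2 ?_
  exact (differentiableOn_mobius ha).continuousOn.comp_continuous continuous_coe_circle
    fun c => sphere_subset_closedBall (coe_circle_mem_sphere c)

theorem continuous_poissonKernel_circle {a : ℂ} (ha : ‖a‖ < 1) :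
    Continuous fun c : Circle => poissonKernel 0 a c :=
  (continuousOn_poissonKernel_sphere ha).comp_continuous continuous_coe_circle coe_circle_mem_sphere

theorem poissonKernel_circle_nonneg {a : ℂ} (ha : ‖a‖ < 1) (c : Circle) :
    0 ≤ poissonKernel 0 a c := by
  rw [poissonKernel_def]
  simp only [sub_zero, Circle.norm_coe]
  have : 0 ≤ 1 ^ 2 - ‖a‖ ^ 2 := by nlinarith [norm_nonneg a]
  positivity

theorem integrable_of_continuous_circle {E : Type*} [NormedAddCommGroup E] {μ : Measure Circle}
    [IsFiniteMeasure μ] {f : Circle → E} (hf : Continuous f) : Integrable f μ :=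
  hf.integrable_of_hasCompactSupport (HasCompactSupport.of_compactSpace _)

/-- A disk automorphism carries arc length to the Poisson measure of its value at the origin. -/
theorem map_mobiusCircle {a : ℂ} (ha : ‖a‖ < 1) :
    circleMeasure.map (mobiusCircle ha) =
      circleMeasure.withDensity fun c => ENNReal.ofReal (poissonKernel 0 a c) := by
  have hP := continuous_poissonKernel_circle ha
  have := Measure.isProbabilityMeasure_map (μ := circleMeasure)
    (continuous_mobiusCircle ha).aemeasurable
  have := isFiniteMeasure_withDensity_ofReal (μ := circleMeasure)
    (integrable_of_continuous_circle hP).2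
  -- Both moments equal `a ^ n`: one by the mean value property of `mobius a ^ n`, the other by
  -- Poisson's formula for `z ^ n`.
  refine circle_measure_ext fun n => ?_
  rw [integral_map (continuous_mobiusCircle ha).aemeasurable
    (Continuous.aestronglyMeasurable (f := fun c : Circle => (c : ℂ) ^ n) (by fun_prop))]
  rw [integral_withDensity_eq_integral_toReal_smul hP.measurable.ennreal_ofReal
    (.of_forall fun _ => ENNReal.ofReal_lt_top)]
  simp_rw [coe_mobiusCircle, ENNReal.toReal_ofReal (poissonKernel_circle_nonneg ha _)]
  have hm : DiffContOnCl ℂ (fun z => mobius a z ^ n) (ball 0 1) := by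
    apply DifferentiableOn.diffContOnCl
    rw [closure_ball 0 one_ne_zero]
    exact (differentiableOn_mobius ha).pow n
  have hd : Differentiable ℂ fun z : ℂ => z ^ n := by fun_prop
  have h1 := integral_circleMeasure (f := fun z : ℂ => mobius a z ^ n)
    (((differentiableOn_mobius ha).pow n).continuousOn.mono sphere_subset_closedBall)
  have h2 := integral_circleMeasure (f := fun z : ℂ => poissonKernel 0 a z • z ^ n)
    ((continuousOn_poissonKernel_sphere ha).smul (by fun_prop))
  rw [h1, h2, DiffContOnCl.circleAverage (f := fun z : ℂ => mobius a z ^ n) (by simpa using hm),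
    mobius_zero]
  exact (DiffContOnCl.circleAverage_poissonKernel_smul (f := fun z : ℂ => z ^ n)
    hd.diffContOnCl (by simpa using ha)).symm

/-- The Poisson integral of `log⁺ |f|` majorizes `log⁺ |f|`. -/
theorem posLog_norm_le_circleAverage_poissonKernel {f : ℂ → ℂ} (hf : DiffContOnCl ℂ f (ball 0 1))
    {a : ℂ} (ha : ‖a‖ < 1) :
    posLog ‖f a‖ ≤ circleAverage (fun z => poissonKernel 0 a z * posLog ‖f z‖) 0 1 := by
  have hP := continuous_poissonKernel_circle ha
  have hm : MapsTo (mobius a) (ball 0 1) (ball 0 1) := fun z hz => by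
    simpa using norm_mobius_lt_one ha (by simpa using hz)
  have hm2 : MapsTo (mobius a) (closedBall 0 1) (closedBall 0 1) := fun z hz => by
    simpa using norm_mobius_le_one ha (by simpa using hz)
  have hcl := closure_ball (0 : ℂ) one_ne_zero
  have hfc : ContinuousOn f (closedBall 0 1) := hcl ▸ hf.continuousOn
  have hfm : ContinuousOn (fun z => f (mobius a z)) (closedBall 0 1) :=
    hfc.comp (differentiableOn_mobius ha).continuousOn hm2
  -- The Poisson inequality at `a` is the mean inequality at the origin for `f ∘ mobius a`,
  -- transported by `map_mobiusCircle`.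
  have h := posLog_norm_le_circleAverage (f := fun z => f (mobius a z))
    (hf.comp (diffContOnCl_mobius ha) hm)
  rw [mobius_zero] at h
  refine h.trans_eq ?_
  have hfs : ContinuousOn (fun z => posLog ‖f z‖) (sphere 0 1) :=
    continuous_posLog.comp_continuousOn (hfc.mono sphere_subset_closedBall).norm
  rw [← integral_circleMeasure (f := fun z => posLog ‖f (mobius a z)‖)
      (continuous_posLog.comp_continuousOn (hfm.mono sphere_subset_closedBall).norm),
    ← integral_circleMeasure (f := fun z => poissonKernel 0 a z * posLog ‖f z‖)
      ((continuousOn_poissonKernel_sphere ha).mul hfs)]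
  have hfC : Continuous fun c : Circle => posLog ‖f c‖ :=
    hfs.comp_continuous continuous_coe_circle coe_circle_mem_sphere
  have e1 := integral_map (μ := circleMeasure) (continuous_mobiusCircle ha).aemeasurable
    (f := fun c : Circle => posLog ‖f c‖) hfC.aestronglyMeasurable
  simp only [coe_mobiusCircle] at e1
  change ∫ c : Circle, posLog ‖f (mobius a c)‖ ∂circleMeasure = _
  rw [← e1, map_mobiusCircle, integral_withDensity_eq_integral_toReal_smul
    hP.measurable.ennreal_ofReal (.of_forall fun _ => ENNReal.ofReal_lt_top)]
  simp_rw [ENNReal.toReal_ofReal (poissonKernel_circle_nonneg ha _), smul_eq_mul]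

end InfPolydisc

/-! ### Fatou's theorem and the Nevanlinna class of the unit disk. -/

namespace InfPolydisc

open Metric Real
open scoped ComplexConjugate

/-- The set of points where a family, continuous in the parameter `r ∈ (0, 1)`, has a limit as
`r → 1⁻` is measurable. -/
theorem measurableSet_exists_tendsto_nhdsLT_one {α : Type*} [MeasurableSpace α] {f : ℝ → α → ℂ}
    (hm : ∀ r ∈ Ioo (0 : ℝ) 1, Measurable (f r))
    (hc : ∀ x, ContinuousOn (fun r => f r x) (Ioo 0 1)) :
    MeasurableSet {x | ∃ l, Tendsto (fun r => f r x) (𝓝[<] 1) (𝓝 l)} := by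
  -- Restricting to rational parameters makes the index set countable; continuity in `r` recovers
  -- the full limit.
  let ι := {q : ℚ // (q : ℝ) ∈ Ioo (0 : ℝ) 1}
  let L : Filter ι := comap (fun q : ι => ((q : ℚ) : ℝ)) (𝓝[<] 1)
  have hM : MeasurableSet {x | ∃ l, Tendsto (fun q : ι => f (q : ℚ) x) L (𝓝 l)} :=
    measurableSet_exists_tendsto fun q => hm _ q.2
  convert hM using 5 with x l
  refine ⟨fun h => h.comp tendsto_comap, fun h => ?_⟩
  rw [Metric.tendsto_nhds] at h ⊢
  intro ε hε
  have h2 := h (ε / 2) (half_pos hε)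
  rw [eventually_comap] at h2
  have h3 : ∀ᶠ r in 𝓝[<] (1 : ℝ), r ∈ Ioo (0 : ℝ) 1 := Ioo_mem_nhdsLT (zero_lt_one' ℝ)
  obtain ⟨a, ha, ha'⟩ := (mem_nhdsLT_iff_exists_Ioo_subset' (zero_lt_one' ℝ)).1 (h2.and h3)
  filter_upwards [Ioo_mem_nhdsLT (show a < 1 from ha)] with r hr
  refine lt_of_le_of_lt (not_lt.1 fun hlt => ?_) (half_lt_self hε)
  have hr2 := (ha' hr).2
  have hca : ContinuousAt (fun r => f r x) r := (hc x).continuousAt (isOpen_Ioo.mem_nhds hr2)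
  have h4 : ∀ᶠ s in 𝓝 r, ε / 2 < dist (f s x) l ∧ s ∈ Ioo a 1 :=
    ((hca.dist continuousAt_const).eventually (lt_mem_nhds hlt)).and (isOpen_Ioo.mem_nhds hr)
  obtain ⟨U, hU, hUo, hrU⟩ := _root_.mem_nhds_iff.1 h4
  obtain ⟨q, hq⟩ := Rat.denseRange_cast.exists_mem_open hUo ⟨r, hrU⟩
  have hq1 := hU hq
  have hq2 := ha' hq1.2
  exact absurd (hq2.1 ⟨q, hq2.2⟩ rfl) (not_lt.2 hq1.1.le)

theorem ae_circleMeasure_of_ae {p : Circle → Prop} (hp : MeasurableSet {c | p c})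
    (h : ∀ᵐ θ : ℝ, p (Circle.exp θ)) : ∀ᵐ c ∂circleMeasure, p c := by
  rw [circleMeasure, ae_map_iff Circle.exp.continuous.aemeasurable hp]
  exact Measure.ae_smul_measure (ae_restrict_of_ae h) _

theorem mul_coe_circle_mem_ball {r : ℝ} (hr : r ∈ Ioo (0 : ℝ) 1) (c : Circle) :
    (r : ℂ) * c ∈ ball (0 : ℂ) 1 := by
  rw [mem_ball_zero_iff, norm_mul, Circle.norm_coe, mul_one, Complex.norm_real, Real.norm_eq_abs,
    abs_of_pos hr.1]
  exact hr.2

theorem measurableSet_exists_radialLimit {f : ℂ → ℂ} (hf : ContinuousOn f (ball 0 1)) :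
    MeasurableSet {c : Circle | ∃ l, Tendsto (fun r : ℝ => f (r * c)) (𝓝[<] 1) (𝓝 l)} := by
  refine measurableSet_exists_tendsto_nhdsLT_one (f := fun r (c : Circle) => f (r * c)) ?_ ?_
  · intro r hr
    exact (hf.comp_continuous (by fun_prop) (mul_coe_circle_mem_ball hr)).measurable
  · intro c
    exact hf.comp (by fun_prop) fun r hr => mul_coe_circle_mem_ball hr c

/-- Fatou's theorem: a bounded holomorphic function on the disk has radial limits almost
everywhere. -/
theorem ae_exists_radialLimit_of_bounded {g : ℂ → ℂ} {M : ℝ}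
    (hg : DifferentiableOn ℂ g (ball 0 1)) (hM : ∀ z ∈ ball (0 : ℂ) 1, ‖g z‖ ≤ M) :
    ∀ᵐ c : Circle ∂circleMeasure, ∃ l, Tendsto (fun r : ℝ => g (r * c)) (𝓝[<] 1) (𝓝 l) := by
  refine ae_circleMeasure_of_ae (measurableSet_exists_radialLimit hg.continuousOn) ?_
  -- A primitive of a bounded function is Lipschitz. Its Lipschitz extension to the plane restricts
  -- to a Lipschitz function of the angle, which is differentiable almost everywhere.
  obtain ⟨Φ, hΦ⟩ := hg.isExactOn_ball
  have hlip : LipschitzOnWith M.toNNReal Φ (ball 0 1) := by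
    refine (convex_ball _ _).lipschitzOnWith_of_nnnorm_deriv_le
      (fun z hz => (hΦ z hz).differentiableAt) fun z hz => ?_
    rw [(hΦ z hz).deriv, ← NNReal.coe_le_coe, coe_nnnorm]
    exact (hM z hz).trans (le_coe_toNNReal M)
  obtain ⟨Ψ, hΨ, hΨΦ⟩ := hlip.extend_finite_dimension
  have hΨd : ∀ z ∈ ball (0 : ℂ) 1, HasDerivAt Ψ (g z) z := by
    intro z hz
    refine (hΦ z hz).congr_of_eventuallyEq ?_
    filter_upwards [isOpen_ball.mem_nhds hz] with w hw using (hΨΦ hw).symm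
  have hΨc : DiffContOnCl ℂ Ψ (ball 0 1) :=
    ⟨fun z hz => (hΨd z hz).differentiableAt.differentiableWithinAt, hΨ.continuous.continuousOn⟩
  have hae := (hΨ.comp (lipschitzWith_circleMap 0 1)).ae_differentiableAt_real
  filter_upwards [hae] with θ hθ
  set D := deriv (Ψ ∘ circleMap 0 1) θ with hD
  have hDd : HasDerivAt (Ψ ∘ circleMap 0 1) D θ := hθ.hasDerivAt
  set ζ : ℂ := (Circle.exp θ : ℂ) with hζ
  have hζn : ‖ζ‖ = 1 := Circle.norm_coe _
  have hζ0 : ζ ≠ 0 := fun h => by simp [h] at hζn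
  -- The curve `e^{it}` has velocity `i` at `t = 0`, so an angular derivative `D` corresponds to the
  -- complex slope `D / i`. Removing that affine part makes `E` vanish to first order at 1 along the
  -- circle.
  let E : ℂ → ℂ := fun z => Ψ (ζ * z) - Ψ ζ - D / Complex.I * (z - 1)
  have hmaps : MapsTo (fun z => ζ * z) (ball (0 : ℂ) 1) (ball 0 1) := by
    intro z hz
    simpa [hζn] using hz
  have hE : DiffContOnCl ℂ E (ball 0 1) := by
    have h1 : DiffContOnCl ℂ (fun z => Ψ (ζ * z)) (ball 0 1) :=
      hΨc.comp (g := fun z => ζ * z) (Differentiable.diffContOnCl (by fun_prop)) hmaps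
    exact (h1.sub diffContOnCl_const).sub (Differentiable.diffContOnCl (by fun_prop))
  have hEo : ∀ ε > 0, ∃ η > 0, ∀ z : ℂ, ‖z‖ = 1 → ‖z - 1‖ < η → ‖E z‖ ≤ ε * ‖z - 1‖ := by
    let e : ℝ → ℂ := fun t => E (Complex.exp (t * Complex.I))
    have he : e =o[𝓝 0] fun t : ℝ => t := by
      have h1 : HasDerivAt (fun t : ℝ => Ψ (circleMap 0 1 (θ + t))) D 0 := by
        have : HasDerivAt (Ψ ∘ circleMap 0 1) D (θ + 0) := by simpa using hDd
        exact this.comp_const_add θ 0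
      have h2 : HasDerivAt (fun t : ℝ => Complex.exp (t * Complex.I)) Complex.I 0 := by
        have := (((hasDerivAt_id (0 : ℝ)).ofReal_comp).mul_const Complex.I).cexp
        simpa using this
      have h3 : HasDerivAt e 0 0 := by
        have := (h1.sub_const (Ψ ζ)).sub ((h2.sub_const 1).const_mul (D / Complex.I))
        rw [div_mul_cancel₀ _ Complex.I_ne_zero, sub_self] at this
        refine this.congr_of_eventuallyEq (.of_forall fun t => ?_)
        simp only [e, E, hζ, circleMap, Circle.coe_exp, Pi.sub_apply]
        push_cast
        rw [← Complex.exp_add]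
        simp [add_mul]
      have h4 := h3.isLittleO
      have h5 : e 0 = 0 := by simp [e, E]
      simpa [h5] using h4
    have harg : Tendsto Complex.arg (𝓝 1) (𝓝 0) := by
      have := Complex.continuousAt_arg (x := 1) (by simp)
      simpa [ContinuousAt] using this
    -- Near 1 the angle, the imaginary part of `log z`, is controlled by the chord `|z - 1|`; this
    -- converts the estimate in `t` to one in `z`.
    have hO : (fun z => Complex.arg z) =O[𝓝 1] fun z : ℂ => z - 1 := by
      have h1 := (Complex.hasDerivAt_log (z := 1) (by simp)).isBigO_sub
      simp only [Complex.log_one, sub_zero] at h1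
      refine Asymptotics.IsBigO.trans ?_ h1
      refine Asymptotics.IsBigO.of_bound 1 (.of_forall fun z => ?_)
      rw [one_mul, Real.norm_eq_abs, ← Complex.log_im]
      exact Complex.abs_im_le_norm _
    have hlo := (he.comp_tendsto harg).trans_isBigO hO
    intro ε hε
    obtain ⟨η, hη, hη'⟩ := Metric.eventually_nhds_iff.1 (hlo.def hε)
    refine ⟨η, hη, fun z hz hz' => ?_⟩
    have := hη' (y := z) (by rwa [dist_eq_norm])
    simp only [Function.comp_apply, e] at this
    have hz2 : Complex.exp (Complex.arg z * Complex.I) = z := by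
      have := Complex.norm_mul_exp_arg_mul_I z
      rwa [hz, Complex.ofReal_one, one_mul] at this
    rwa [hz2] at this
  have hlim := tendsto_deriv_of_isLittleO hE hEo
  refine ⟨D / Complex.I / ζ, ?_⟩
  have h2 : Tendsto (fun r : ℝ => (deriv E r + D / Complex.I) / ζ) (𝓝[<] 1)
      (𝓝 (D / Complex.I / ζ)) := by
    simpa using (hlim.add_const (D / Complex.I)).div_const ζ
  refine h2.congr' ?_
  filter_upwards [Ioo_mem_nhdsLT (zero_lt_one' ℝ)] with r hr
  have hb := mul_coe_circle_mem_ball hr (Circle.exp θ)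
  have h3 : HasDerivAt E (g (r * ζ) * ζ - D / Complex.I) r := by
    have h4 : HasDerivAt (fun z => ζ * z) ζ (r : ℂ) := by
      simpa using (hasDerivAt_id (r : ℂ)).const_mul ζ
    have h5 := (hΨd _ hb)
    rw [mul_comm] at h5
    have h6 := h5.comp (r : ℂ) h4
    have h7 := ((hasDerivAt_id (r : ℂ)).sub_const 1).const_mul (D / Complex.I)
    rw [mul_comm (r : ℂ)]
    have h8 : HasDerivAt E (g (ζ * r) * ζ - D / Complex.I * 1) r := (h6.sub_const (Ψ ζ)).sub h7
    rwa [mul_one] at h8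
  rw [h3.deriv]
  field_simp
  ring

theorem diffContOnCl_comp_mul {f : ℂ → ℂ} (hf : DifferentiableOn ℂ f (ball 0 1)) {r : ℝ}
    (hr : r ∈ Ioo (0 : ℝ) 1) : DiffContOnCl ℂ (fun z => f (r * z)) (ball 0 1) := by
  apply DifferentiableOn.diffContOnCl
  rw [closure_ball 0 one_ne_zero]
  refine hf.comp (by fun_prop) fun z hz => ?_
  rw [mem_ball_zero_iff, norm_mul, Complex.norm_real, Real.norm_eq_abs, abs_of_pos hr.1]
  rw [mem_closedBall_zero_iff] at hz
  nlinarith [hr.1, hr.2]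

/-- The radial limits of a bounded holomorphic function are almost everywhere nonzero. -/
theorem ae_radialLimit_ne_zero {h : ℂ → ℂ} (hd : DifferentiableOn ℂ h (ball 0 1))
    (h1 : ∀ z ∈ ball (0 : ℂ) 1, ‖h z‖ ≤ 1) (h0 : h 0 ≠ 0) :
    ∀ᵐ c : Circle ∂circleMeasure, ∃ l ≠ 0, Tendsto (fun r : ℝ => h (r * c)) (𝓝[<] 1) (𝓝 l) := by
  have hlim := ae_exists_radialLimit_of_bounded hd h1
  have hcont : ∀ r ∈ Ioo (0 : ℝ) 1, Continuous fun c : Circle => h (r * c) := fun r hr =>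
    hd.continuousOn.comp_continuous (by fun_prop) (mul_coe_circle_mem_ball hr)
  obtain ⟨u, -, hu, hut⟩ := exists_seq_strictMono_tendsto' (zero_lt_one' ℝ)
  have hut' : Tendsto u atTop (𝓝[<] 1) :=
    tendsto_nhdsWithin_iff.2 ⟨hut, .of_forall fun n => (hu n).2⟩
  let hs0 : Circle → ℂ := fun c => limUnder (𝓝[<] (1 : ℝ)) fun r => h (r * c)
  have hs0t : ∀ᵐ c : Circle ∂circleMeasure,
      Tendsto (fun r : ℝ => h (r * c)) (𝓝[<] 1) (𝓝 (hs0 c)) := by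
    filter_upwards [hlim] with c hc using tendsto_nhds_limUnder hc
  have hs0m : AEMeasurable hs0 circleMeasure := by
    refine aemeasurable_of_tendsto_metrizable_ae atTop (f := fun n c => h (u n * (c : Circle)))
      (fun n => (hcont _ (hu n)).aemeasurable) ?_
    filter_upwards [hs0t] with c hc using hc.comp hut'
  let hs := hs0m.mk hs0
  have hst : ∀ᵐ c : Circle ∂circleMeasure,
      Tendsto (fun r : ℝ => h (r * c)) (𝓝[<] 1) (𝓝 (hs c)) := by
    filter_upwards [hs0t, hs0m.ae_eq_mk] with c hc hc2
    rwa [hc2] at hc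
  let Z : Set Circle := hs ⁻¹' {0}
  have hZm : MeasurableSet Z := hs0m.measurable_mk (measurableSet_singleton 0)
  -- The mean inequality for `e^L h` gives `L + log |h 0| ≤ ∫ log⁺ |e^L h*| ≤ L (1 - m(Z))`, where
  -- `Z` is the zero set of the limit function. Since `L` is arbitrary, `Z` must be null.
  have key : ∀ L : ℝ, 0 < L → L * circleMeasure.real Z ≤ -Real.log ‖h 0‖ := by
    intro L hL
    have hmulle : ∀ x : ℂ, ‖x‖ ≤ 1 → posLog (exp L * ‖x‖) ≤ L := by
      intro x hx
      refine (posLog_le_posLog (by positivity) (mul_le_of_le_one_right (by positivity) hx)).trans ?_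
      rw [posLog_apply, Real.log_exp]
      exact max_le hL.le le_rfl
    have hJ : ∀ n, posLog (exp L * ‖h 0‖) ≤
        ∫ c : Circle, posLog (exp L * ‖h (u n * c)‖) ∂circleMeasure := by
      intro n
      have hD := (diffContOnCl_comp_mul hd (hu n)).const_smul (exp L : ℂ)
      have := posLog_norm_le_circleAverage hD
      have hcs : ContinuousOn (fun z => posLog (exp L * ‖h (u n * z)‖)) (sphere 0 1) := by
        have hc := (diffContOnCl_comp_mul hd (hu n)).continuousOn
        rw [closure_ball 0 one_ne_zero] at hc
        exact continuous_posLog.comp_continuousOn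
          ((hc.mono sphere_subset_closedBall).norm.const_mul _)
      rw [integral_circleMeasure (f := fun z => posLog (exp L * ‖h (u n * z)‖)) hcs]
      have hn : ‖(exp L : ℂ)‖ = exp L := by
        rw [Complex.norm_real, Real.norm_eq_abs, abs_of_pos (exp_pos L)]
      simpa [norm_smul, hn] using this
    have ht : Tendsto (fun n => ∫ c : Circle, posLog (exp L * ‖h (u n * c)‖) ∂circleMeasure) atTop
        (𝓝 (∫ c : Circle, posLog (exp L * ‖hs c‖) ∂circleMeasure)) := by
      refine tendsto_integral_of_dominated_convergence (fun _ => L) ?_ (integrable_const _) ?_ ?_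
      · intro n
        exact (continuous_posLog.comp
          ((hcont _ (hu n)).norm.const_mul _)).aestronglyMeasurable
      · intro n
        refine .of_forall fun c => ?_
        rw [Real.norm_eq_abs, abs_of_nonneg posLog_nonneg]
        exact hmulle _ (h1 _ (mul_coe_circle_mem_ball (hu n) c))
      · filter_upwards [hst] with c hc
        exact (continuous_posLog.tendsto _).comp (((hc.comp hut').norm).const_mul _)
    have h3 : posLog (exp L * ‖h 0‖) ≤ ∫ c : Circle, posLog (exp L * ‖hs c‖) ∂circleMeasure :=
      ge_of_tendsto' ht hJ
    have h4 : ∫ c : Circle, posLog (exp L * ‖hs c‖) ∂circleMeasure ≤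
        ∫ c : Circle, Zᶜ.indicator (fun _ => L) c ∂circleMeasure := by
      refine integral_mono_of_nonneg (.of_forall fun _ => posLog_nonneg)
        ((integrable_const L).indicator hZm.compl) ?_
      filter_upwards [hst] with c hc
      by_cases hcZ : c ∈ Z
      · have : hs c = 0 := hcZ
        simp [this, hcZ]
      · simp only [mem_compl_iff, hcZ, not_false_eq_true, indicator_of_mem]
        refine hmulle _ ?_
        refine le_of_tendsto hc.norm ?_
        filter_upwards [Ioo_mem_nhdsLT (zero_lt_one' ℝ)] with r hr
        exact h1 _ (mul_coe_circle_mem_ball hr c)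
    rw [integral_indicator_const _ hZm.compl, smul_eq_mul, probReal_compl_eq_one_sub hZm] at h4
    have h5 : L + Real.log ‖h 0‖ ≤ posLog (exp L * ‖h 0‖) := by
      rw [posLog_apply, Real.log_mul (exp_pos L).ne' (norm_ne_zero_iff.2 h0), Real.log_exp]
      exact le_max_right _ _
    nlinarith
  have hZ0 : circleMeasure Z = 0 := by
    by_contra hne
    have hpos : 0 < circleMeasure.real Z :=
      ENNReal.toReal_pos hne (measure_ne_top _ _)
    have h6 := key ((-Real.log ‖h 0‖ + 1) / circleMeasure.real Z) (by
      have : Real.log ‖h 0‖ ≤ 0 := Real.log_nonpos (norm_nonneg _) (h1 0 (by simp))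
      have : 0 < -Real.log ‖h 0‖ + 1 := by linarith
      positivity)
    rw [div_mul_cancel₀ _ hpos.ne'] at h6
    linarith
  filter_upwards [hst, measure_eq_zero_iff_ae_notMem.1 hZ0] with c hc hcZ
  exact ⟨hs c, fun h => hcZ h, hc⟩

/-- Montel's theorem for the unit ball of `H^∞`, along an ultrafilter. -/
theorem exists_ultrafilter_tendsto {h : ℕ → ℂ → ℂ} (hd : ∀ n, DifferentiableOn ℂ (h n) (ball 0 1))
    (h1 : ∀ n, ∀ z ∈ ball (0 : ℂ) 1, ‖h n z‖ ≤ 1) (𝒰 : Ultrafilter ℕ) :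
    ∃ H : ℂ → ℂ, DifferentiableOn ℂ H (ball 0 1) ∧
      ∀ z ∈ ball (0 : ℂ) 1, Tendsto (fun n => h n z) 𝒰 (𝓝 (H z)) := by
  -- By Cauchy's estimates all Taylor coefficients lie in the closed unit disk, so they converge
  -- along the ultrafilter without any diagonal extraction; dominated convergence sums the limits.
  let a : ℕ → ℕ → ℂ := fun n k => (k.factorial : ℂ)⁻¹ * iteratedDeriv k (h n) 0
  have ha : ∀ n k, ‖a n k‖ ≤ 1 := by
    intro n k
    have hR : ∀ R ∈ Ioo (0 : ℝ) 1, ‖a n k‖ ≤ 1 / R ^ k := by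
      intro R hR
      have h2 : DiffContOnCl ℂ (h n) (ball 0 R) := by
        apply DifferentiableOn.diffContOnCl
        rw [closure_ball 0 hR.1.ne']
        exact (hd n).mono (closedBall_subset_ball hR.2)
      have h3 := Complex.norm_iteratedDeriv_le_of_forall_mem_sphere_norm_le k hR.1 h2
        (C := 1) fun z hz => h1 n z (by
          rw [mem_sphere_zero_iff_norm] at hz
          rw [mem_ball_zero_iff, hz]
          exact hR.2)
      have hk : (0 : ℝ) < k.factorial := by exact_mod_cast k.factorial_pos
      simp only [a]
      rw [norm_mul, norm_inv, Complex.norm_natCast, inv_mul_le_iff₀ hk]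
      calc _ ≤ _ := h3
        _ = _ := by ring
    have ht : Tendsto (fun R : ℝ => 1 / R ^ k) (𝓝[<] 1) (𝓝 (1 / 1 ^ k)) := by
      refine Tendsto.mono_left ?_ nhdsWithin_le_nhds
      exact ((continuousAt_const).div (by fun_prop) (by simp)).tendsto
    rw [one_pow, div_one] at ht
    refine ge_of_tendsto ht ?_
    filter_upwards [Ioo_mem_nhdsLT (zero_lt_one' ℝ)] with R hR' using hR R hR'
  have hA : ∀ k, ∃ A : ℂ, ‖A‖ ≤ 1 ∧ Tendsto (fun n => a n k) 𝒰 (𝓝 A) := by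
    intro k
    obtain ⟨A, hA, hA2⟩ := (isCompact_closedBall (0 : ℂ) 1).ultrafilter_le_nhds'
      (𝒰.map fun n => a n k) (Ultrafilter.mem_map.2 (Filter.univ_mem' fun n => by
        simpa using ha n k))
    exact ⟨A, by simpa using hA, hA2⟩
  choose A hA1 hA2 using hA
  refine ⟨fun z => ∑' k, A k * z ^ k, ?_, ?_⟩
  · intro z hz
    have hz1 : ‖z‖ < 1 := by simpa using hz
    obtain ⟨R, hzR, hR1⟩ := exists_between hz1
    have hR0 : 0 ≤ R := (norm_nonneg z).trans hzR.le
    have : DifferentiableOn ℂ (fun z => ∑' k, A k * z ^ k) (ball 0 R) := by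
      refine Complex.differentiableOn_tsum_of_summable_norm (summable_geometric_of_lt_one hR0 hR1)
        (fun k => by fun_prop) isOpen_ball fun k w hw => ?_
      rw [norm_mul, norm_pow]
      rw [mem_ball_zero_iff] at hw
      calc ‖A k‖ * ‖w‖ ^ k ≤ 1 * R ^ k := by
            gcongr
            exact hA1 k
        _ = R ^ k := one_mul _
    exact (this.differentiableAt (isOpen_ball.mem_nhds (by simpa using hzR))).differentiableWithinAt
  · intro z hz
    have hz1 : ‖z‖ < 1 := by simpa using hz
    have hs : ∀ n, h n z = ∑' k, a n k * z ^ k := by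
      intro n
      have := (Complex.hasSum_taylorSeries_on_ball (hd n) hz).tsum_eq
      rw [← this]
      refine tsum_congr fun k => ?_
      simp only [a, smul_eq_mul, sub_zero]
      ring
    simp_rw [hs]
    refine tendsto_tsum_of_dominated_convergence
      (summable_geometric_of_lt_one (norm_nonneg z) hz1) (fun k => (hA2 k).mul_const _)
      (.of_forall fun n k => ?_)
    rw [norm_mul, norm_pow]
    exact mul_le_of_le_one_left (by positivity) (ha n k)

/-- The outer function whose modulus on the circle is `1 / max(1, |f|)`. -/
theorem exists_outer {f : ℂ → ℂ} (hf : DiffContOnCl ℂ f (ball 0 1)) :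
    ∃ h : ℂ → ℂ, DifferentiableOn ℂ h (ball 0 1) ∧ (∀ z ∈ ball (0 : ℂ) 1, ‖h z‖ ≤ 1) ∧
      (∀ z ∈ ball (0 : ℂ) 1, ‖f z * h z‖ ≤ 1) ∧
      ‖h 0‖ = exp (-circleAverage (fun z => posLog ‖f z‖) 0 1) := by
  have hfs : ContinuousOn (fun z => posLog ‖f z‖) (sphere 0 1) := by
    have := hf.continuousOn
    rw [closure_ball 0 one_ne_zero] at this
    exact continuous_posLog.comp_continuousOn (this.mono sphere_subset_closedBall).norm
  have hint : CircleIntegrable (fun z => posLog ‖f z‖) 0 1 := hfs.circleIntegrable zero_le_one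
  have hintC : CircleIntegrable (fun z => ((posLog ‖f z‖ : ℝ) : ℂ)) 0 1 :=
    (Complex.continuous_ofReal.comp_continuousOn hfs).circleIntegrable zero_le_one
  -- The Herglotz integral of `log⁺ |f|`: its real part is the Poisson integral, which majorizes
  -- `log⁺ |f|`, so `exp (-k)` and `f exp (-k)` are both bounded by 1.
  let k : ℂ → ℂ := fun w =>
    circleAverage (fun ζ => herglotzRieszKernel 0 w ζ • ((posLog ‖f ζ‖ : ℝ) : ℂ)) 0 1
  have hk : DifferentiableOn ℂ k (ball 0 1) :=
    differentiableOn_circleAverage_herglotzRieszKernel_smul hintC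
  have hre : ∀ w ∈ ball (0 : ℂ) 1,
      (k w).re = circleAverage (fun z => poissonKernel 0 w z * posLog ‖f z‖) 0 1 := by
    intro w hw
    have := re_circleAverage_herglotzRieszKernel_smul hint hw
    rw [← poissonKernel_eq_re_herglotzRieszKernel] at this
    exact this
  have hge : ∀ w ∈ ball (0 : ℂ) 1, posLog ‖f w‖ ≤ (k w).re := by
    intro w hw
    rw [hre w hw]
    exact posLog_norm_le_circleAverage_poissonKernel hf (by simpa using hw)
  refine ⟨fun w => Complex.exp (-k w), hk.neg.cexp, fun w hw => ?_, fun w hw => ?_, ?_⟩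
  · rw [Complex.norm_exp, Complex.neg_re, Real.exp_le_one_iff]
    linarith [hge w hw, posLog_nonneg (x := ‖f w‖)]
  · rw [norm_mul, Complex.norm_exp, Complex.neg_re, Real.exp_neg, ← div_eq_mul_inv,
      div_le_one (exp_pos _)]
    rcases eq_or_ne (f w) 0 with h | h
    · simp [h, (exp_pos _).le]
    · rw [← Real.log_le_iff_le_exp (norm_pos_iff.2 h)]
      exact (le_max_right _ _).trans (hge w hw)
  · rw [Complex.norm_exp, Complex.neg_re, hre 0 (by simp)]
    congr 2
    refine circleAverage_congr_sphere fun z hz => ?_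
    have hz1 : ‖z‖ = 1 := by simpa using hz
    simp [poissonKernel_def, hz1]

/-- A function on the disk whose means of `log⁺ |f|` over some circles tending to the boundary stay
bounded is a quotient of bounded holomorphic functions. -/
theorem exists_bounded_factor {f : ℂ → ℂ} (hf : DifferentiableOn ℂ f (ball 0 1)) {u : ℕ → ℝ}
    (hu : ∀ n, u n ∈ Ioo (0 : ℝ) 1) (hut : Tendsto u atTop (𝓝 1)) {C : ℝ}
    (hC : ∃ᶠ n in atTop, circleAverage (fun z => posLog ‖f (u n * z)‖) 0 1 ≤ C) :
    ∃ h : ℂ → ℂ, DifferentiableOn ℂ h (ball 0 1) ∧ (∀ z ∈ ball (0 : ℂ) 1, ‖h z‖ ≤ 1) ∧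
      (∀ z ∈ ball (0 : ℂ) 1, ‖f z * h z‖ ≤ 1) ∧ h 0 ≠ 0 := by
  choose h hd h1 h2 h3 using fun n => exists_outer (diffContOnCl_comp_mul hf (hu n))
  have hne : NeBot (atTop ⊓ 𝓟 {n | circleAverage (fun z => posLog ‖f (u n * z)‖) 0 1 ≤ C}) :=
    frequently_mem_iff_neBot.1 hC
  -- The ultrafilter lives on the indices where the mean is at most `C`; this keeps `|h n 0| ≥ exp
  -- (-C)`, so the limit does not vanish at the origin.
  let 𝒰 := Ultrafilter.of (atTop ⊓ 𝓟 {n | circleAverage (fun z => posLog ‖f (u n * z)‖) 0 1 ≤ C})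
  have h𝒰 := Ultrafilter.of_le
    (atTop ⊓ 𝓟 {n | circleAverage (fun z => posLog ‖f (u n * z)‖) 0 1 ≤ C})
  have h𝒰1 : (𝒰 : Filter ℕ) ≤ atTop := h𝒰.trans inf_le_left
  have h𝒰2 : ∀ᶠ n in (𝒰 : Filter ℕ), circleAverage (fun z => posLog ‖f (u n * z)‖) 0 1 ≤ C :=
    (h𝒰.trans inf_le_right) (mem_principal_self _)
  obtain ⟨H, hH, hHt⟩ := exists_ultrafilter_tendsto hd h1 𝒰
  refine ⟨H, hH, fun z hz => ?_, fun z hz => ?_, fun h0 => ?_⟩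
  · exact le_of_tendsto (hHt z hz).norm (.of_forall fun n => h1 n z hz)
  · have ht : Tendsto (fun n => f (u n * z)) 𝒰 (𝓝 (f z)) := by
      have hc : ContinuousAt f z := (hf.differentiableAt (isOpen_ball.mem_nhds hz)).continuousAt
      have h5 : Tendsto (fun n => (u n : ℂ) * z) atTop (𝓝 z) := by
        have := ((Complex.continuous_ofReal.tendsto 1).comp hut).mul_const z
        simpa using this
      exact hc.tendsto.comp (h5.mono_left h𝒰1)
    exact le_of_tendsto (ht.mul (hHt z hz)).norm (.of_forall fun n => h2 n z hz)
  · have h6 : exp (-C) ≤ ‖H 0‖ := by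
      refine ge_of_tendsto (hHt 0 (by simp)).norm ?_
      filter_upwards [h𝒰2] with n hn
      rw [h3 n]
      exact exp_le_exp.2 (neg_le_neg hn)
    rw [h0, norm_zero] at h6
    exact absurd h6 (not_le.2 (exp_pos _))

/-- Radial limits exist almost everywhere for functions of the Nevanlinna class of the disk. -/
theorem ae_exists_radialLimit {f : ℂ → ℂ} (hf : DifferentiableOn ℂ f (ball 0 1)) {u : ℕ → ℝ}
    (hu : ∀ n, u n ∈ Ioo (0 : ℝ) 1) (hut : Tendsto u atTop (𝓝 1)) {C : ℝ}
    (hC : ∃ᶠ n in atTop, circleAverage (fun z => posLog ‖f (u n * z)‖) 0 1 ≤ C) :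
    ∀ᵐ c : Circle ∂circleMeasure, ∃ l, Tendsto (fun r : ℝ => f (r * c)) (𝓝[<] 1) (𝓝 l) := by
  obtain ⟨h, hd, h1, h2, h0⟩ := exists_bounded_factor hf hu hut hC
  filter_upwards [ae_radialLimit_ne_zero hd h1 h0,
    ae_exists_radialLimit_of_bounded (hf.mul hd) h2] with c ⟨l, hl, hlt⟩ ⟨m, hm⟩
  refine ⟨m / l, (hm.div hlt hl).congr' ?_⟩
  filter_upwards [hlt.eventually_ne hl] with r hr
  exact mul_div_cancel_right₀ _ hr

end InfPolydisc

/-! ### From holomorphy on lines to Fréchet differentiability. -/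

namespace InfPolydisc

open Metric

section Gateaux

variable {X : Type*} [NormedAddCommGroup X] [NormedSpace ℂ X] {F : X → ℂ} {V : Set X}

/-- First and second order estimates along a complex line for a bounded holomorphic function. -/
theorem line_estimates {φ : ℂ → ℂ} {C : ℝ} (hd : DifferentiableOn ℂ φ (ball 0 1))
    (hC : ∀ z ∈ ball (0 : ℂ) 1, ‖φ z‖ ≤ C) {z : ℂ} (hz : ‖z‖ < 1) :
    ‖φ z - φ 0‖ ≤ 2 * C * ‖z‖ ∧ ‖deriv φ 0‖ ≤ 2 * C ∧
      ‖φ z - φ 0 - z * deriv φ 0‖ ≤ 4 * C * ‖z‖ ^ 2 := by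
  have h0 : (0 : ℂ) ∈ ball (0 : ℂ) 1 := by simp
  have hzb : z ∈ ball (0 : ℂ) 1 := by simpa using hz
  have hmaps : MapsTo φ (ball 0 1) (closedBall (φ 0) (2 * C)) := by
    intro w hw
    rw [mem_closedBall, dist_eq_norm]
    have := norm_sub_le (φ w) (φ 0)
    linarith [hC w hw, hC 0 h0]
  have hder := Complex.norm_deriv_le_div_of_mapsTo_ball hd hmaps one_pos
  rw [div_one] at hder
  refine ⟨?_, hder, ?_⟩
  · have := Complex.dist_le_div_mul_dist_of_mapsTo_ball hd hmaps hzb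
    simpa [dist_eq_norm] using this
  -- Without its linear term the function has zero derivative at the origin, and the second-order
  -- Schwarz lemma applies; `4 * C` is `2 * C` from `φ` plus `2 * C` from the linear term.
  · let ψ : ℂ → ℂ := fun w => φ w - w * deriv φ 0
    have hψd : DifferentiableOn ℂ ψ (ball 0 1) := hd.sub (by fun_prop)
    have hψm : MapsTo ψ (ball 0 1) (closedBall (ψ 0) (4 * C)) := by
      intro w hw
      have h1 := hmaps hw
      rw [mem_closedBall, dist_eq_norm] at h1 ⊢
      have hw1 : ‖w‖ < 1 := by simpa using hw
      have e : ψ w - ψ 0 = (φ w - φ 0) - w * deriv φ 0 := by simp [ψ]; ring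
      have h2 : ‖w * deriv φ 0‖ ≤ 1 * (2 * C) := by
        rw [norm_mul]
        gcongr
      rw [e]
      have := norm_sub_le (φ w - φ 0) (w * deriv φ 0)
      linarith
    have hψo : (fun w => ψ w - ψ 0) =o[𝓝 0] fun w : ℂ => ‖w - 0‖ ^ 1 := by
      have h1 := ((hd.differentiableAt (isOpen_ball.mem_nhds h0)).hasDerivAt).isLittleO
      simp only [pow_one]
      refine Asymptotics.IsLittleO.norm_right ?_
      refine h1.congr_left fun w => ?_
      simp [ψ]
      ring
    have := Complex.dist_le_mul_div_pow_of_mapsTo_ball_of_isLittleO hψd hψm hψo hzb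
    have e : ψ z - ψ 0 = φ z - φ 0 - z * deriv φ 0 := by simp only [ψ, zero_mul]; ring
    rwa [dist_eq_norm, dist_zero_right, div_one, e] at this

/-- A locally bounded function that is holomorphic along complex lines is Fréchet differentiable. -/
theorem IsHolomorphicOn.differentiableAt (h : IsHolomorphicOn F V) (hV : IsOpen V) {x : X}
    (hx : x ∈ V) : DifferentiableAt ℂ F x := by
  obtain ⟨U, hU, C, hC⟩ := h.1 x hx
  obtain ⟨ρ, hρ, hρU⟩ := Metric.mem_nhds_iff.1 (inter_mem hU (hV.mem_nhds hx))
  have hC0 : 0 ≤ C := (norm_nonneg _).trans (hC x (hρU (mem_ball_self hρ)))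
  let d : X → X → ℂ := fun y v => deriv (fun z : ℂ => F (y + z • v)) 0
  have hin : ∀ y v : X, ‖y - x‖ < ρ / 2 → ‖v‖ < ρ / 2 → ∀ z ∈ ball (0 : ℂ) 1,
      y + z • v ∈ ball x ρ := by
    intro y v hy hv z hz
    have hz1 : ‖z‖ < 1 := by simpa using hz
    rw [mem_ball, dist_eq_norm]
    have e : y + z • v - x = (y - x) + z • v := by abel
    have h1 := norm_add_le (y - x) (z • v)
    rw [norm_smul] at h1
    have h2 : ‖z‖ * ‖v‖ ≤ 1 * ‖v‖ := by gcongr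
    rw [e]
    linarith
  have est : ∀ y v : X, ‖y - x‖ < ρ / 2 → ‖v‖ < ρ / 2 → ∀ z : ℂ, ‖z‖ < 1 →
      ‖F (y + z • v) - F y‖ ≤ 2 * C * ‖z‖ ∧ ‖d y v‖ ≤ 2 * C ∧
        ‖F (y + z • v) - F y - z * d y v‖ ≤ 4 * C * ‖z‖ ^ 2 := by
    intro y v hy hv z hz
    have hyV : y ∈ V := by
      have := (hρU (hin y v hy hv 0 (by simp))).2
      simpa using this
    have hd : DifferentiableOn ℂ (fun z : ℂ => F (y + z • v)) (ball 0 1) :=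
      (h.2 y hyV v).mono fun z hz => (hρU (hin y v hy hv z hz)).2
    have := line_estimates (C := C) hd (fun z hz => hC _ (hρU (hin y v hy hv z hz))) hz
    simpa using this
  have hhom : ∀ y v : X, ∀ a : ℂ, d y (a • v) = a * d y v := by
    intro y v a
    have := deriv_comp_mul_left a (fun z : ℂ => F (y + z • v)) 0
    simp only [mul_zero, smul_eq_mul] at this
    rw [← this]
    simp only [d]
    congr 1
    ext z
    rw [smul_smul, mul_comm]
  have hadd_small : ∀ u v : X, ‖u‖ < ρ / 4 → ‖v‖ < ρ / 4 → d x (u + v) = d x u + d x v := by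
    intro u v hu hv
    -- Two scales are used. With `y = x + s² u`, first-order expansions with step `s²` give `d x (u
    -- + v) - d x u - d y v = O(s²)`. With step `s` along `v`, moving the base point from `x` to `y`
    -- changes `F` by `O(s²)`, so division by `s` gives `d y v - d x v = O(s)`.
    have hbound : ∀ s ∈ Ioo (0 : ℝ) 1, ‖d x (u + v) - d x u - d x v‖ ≤ 24 * C * s := by
      intro s hs
      have hsn : ‖(s : ℂ)‖ = s := by
        rw [Complex.norm_real, Real.norm_eq_abs, abs_of_pos hs.1]
      have hsn2 : ‖(s : ℂ) ^ 2‖ = s ^ 2 := by rw [norm_pow, hsn]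
      have hs2 : s ^ 2 < 1 := by nlinarith [hs.1, hs.2]
      have hs0 : (s : ℂ) ≠ 0 := by exact_mod_cast hs.1.ne'
      have hx0 : ‖x - x‖ < ρ / 2 := by simpa using half_pos hρ
      have hu2 : ‖u‖ < ρ / 2 := by linarith
      have hv2 : ‖v‖ < ρ / 2 := by linarith
      have huv : ‖u + v‖ < ρ / 2 := by linarith [norm_add_le u v]
      let z : ℂ := (s : ℂ) ^ 2
      have hz : ‖z‖ < 1 := by rw [hsn2]; exact hs2
      let y := x + z • u
      have hyu : ‖z • u‖ < ρ / 4 := by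
        rw [norm_smul, hsn2]
        nlinarith [norm_nonneg u]
      have hy : ‖y - x‖ < ρ / 2 := by
        have : y - x = z • u := by simp [y]
        rw [this]; linarith
      have hsv : ‖x + (s : ℂ) • v - x‖ < ρ / 2 := by
        rw [add_sub_cancel_left, norm_smul, hsn]
        nlinarith [norm_nonneg v, hs.1, hs.2]
      have hs1 : ‖(s : ℂ)‖ < 1 := by rw [hsn]; exact hs.2
      have e1 := (est x (u + v) hx0 huv z hz).2.2
      have e2 := (est y v hy hv2 z hz).2.2
      have e3 := (est x u hx0 hu2 z hz).2.2
      have e4 := (est y v hy hv2 s hs1).2.2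
      have e5 := (est x v hx0 hv2 s hs1).2.2
      have e6 := (est (x + (s : ℂ) • v) u hsv hu2 z hz).1
      have e7 := (est x u hx0 hu2 z hz).1
      rw [hsn] at e4 e5
      have hzn : ‖z‖ = s ^ 2 := hsn2
      rw [hzn] at e1 e2 e3 e6 e7
      have c1 : x + z • (u + v) = y + z • v := by simp only [y, smul_add]; abel
      have c2 : x + (s : ℂ) • v + z • u = y + (s : ℂ) • v := by simp only [y]; abel
      rw [c1] at e1
      rw [c2] at e6
      change ‖F y - F x - z * d x u‖ ≤ _ at e3
      change ‖F y - F x‖ ≤ _ at e7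
      have g1 : ‖z * (d x (u + v) - d x u - d y v)‖ ≤ 12 * C * (s ^ 2) ^ 2 := by
        have : z * (d x (u + v) - d x u - d y v) =
            (F (y + z • v) - F y - z * d y v) + (F y - F x - z * d x u) -
              (F (y + z • v) - F x - z * d x (u + v)) := by ring
        rw [this]
        have h1 := norm_sub_le ((F (y + z • v) - F y - z * d y v) + (F y - F x - z * d x u))
          (F (y + z • v) - F x - z * d x (u + v))
        have h2 := norm_add_le (F (y + z • v) - F y - z * d y v) (F y - F x - z * d x u)
        linarith
      have g2 : ‖(s : ℂ) * (d y v - d x v)‖ ≤ 12 * C * s ^ 2 := by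
        have : (s : ℂ) * (d y v - d x v) =
            (F (y + (s : ℂ) • v) - F (x + (s : ℂ) • v)) - (F y - F x) -
              ((F (y + (s : ℂ) • v) - F y - s * d y v) -
                (F (x + (s : ℂ) • v) - F x - s * d x v)) := by ring
        rw [this]
        have h1 := norm_sub_le ((F (y + (s : ℂ) • v) - F (x + (s : ℂ) • v)) - (F y - F x))
          ((F (y + (s : ℂ) • v) - F y - s * d y v) - (F (x + (s : ℂ) • v) - F x - s * d x v))
        have h2 := norm_sub_le (F (y + (s : ℂ) • v) - F (x + (s : ℂ) • v)) (F y - F x)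
        have h3 := norm_sub_le (F (y + (s : ℂ) • v) - F y - s * d y v)
          (F (x + (s : ℂ) • v) - F x - s * d x v)
        linarith
      rw [norm_mul, hzn] at g1
      rw [norm_mul, hsn] at g2
      have g1' : ‖d x (u + v) - d x u - d y v‖ ≤ 12 * C * s := by
        have h1 : ‖d x (u + v) - d x u - d y v‖ ≤ 12 * C * s ^ 2 := by
          have hp : 0 < s ^ 2 := pow_pos hs.1 2
          refine le_of_mul_le_mul_left ?_ hp
          linarith
        refine h1.trans ?_
        have : s ^ 2 ≤ s := by nlinarith [hs.1, hs.2]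
        gcongr
      have g2' : ‖d y v - d x v‖ ≤ 12 * C * s := by
        refine le_of_mul_le_mul_left ?_ hs.1
        linarith
      have : d x (u + v) - d x u - d x v = (d x (u + v) - d x u - d y v) + (d y v - d x v) := by
        ring
      rw [this]
      linarith [norm_add_le (d x (u + v) - d x u - d y v) (d y v - d x v)]
    have hlim : Tendsto (fun s : ℝ => 24 * C * s) (𝓝[>] 0) (𝓝 (24 * C * 0)) :=
      (Continuous.tendsto (by fun_prop) 0).mono_left nhdsWithin_le_nhds
    have hle : ‖d x (u + v) - d x u - d x v‖ ≤ 24 * C * 0 := by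
      refine ge_of_tendsto hlim ?_
      filter_upwards [Ioo_mem_nhdsGT (zero_lt_one' ℝ)] with s hs using hbound s hs
    rw [mul_zero, norm_le_zero_iff] at hle
    linear_combination hle
  have hadd : ∀ u v : X, d x (u + v) = d x u + d x v := by
    intro u v
    -- Homogeneity reduces additivity to small vectors; this scale makes both vectors shorter than
    -- `ρ / 4`.
    let t : ℝ := ρ / (8 * (‖u‖ + ‖v‖ + 1))
    have hpos : 0 < ‖u‖ + ‖v‖ + 1 := by positivity
    have ht : 0 < t := by positivity
    have htn : ‖(t : ℂ)‖ = t := by rw [Complex.norm_real, Real.norm_eq_abs, abs_of_pos ht]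
    have hsm : ∀ w : X, ‖w‖ ≤ ‖u‖ + ‖v‖ → ‖(t : ℂ) • w‖ < ρ / 4 := by
      intro w hw
      rw [norm_smul, htn]
      have h1 : t * ‖w‖ ≤ t * (‖u‖ + ‖v‖ + 1) := by gcongr; linarith
      have h2 : t * (‖u‖ + ‖v‖ + 1) = ρ / 8 := by simp only [t]; field_simp
      linarith
    have h1 := hadd_small ((t : ℂ) • u) ((t : ℂ) • v) (hsm u (by linarith [norm_nonneg v]))
      (hsm v (by linarith [norm_nonneg u]))
    rw [← smul_add, hhom, hhom, hhom, ← mul_add] at h1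
    exact mul_left_cancel₀ (by exact_mod_cast ht.ne') h1
  have hscale : ∀ w : X, ∃ (z : ℂ) (v : X), ‖v‖ < ρ / 2 ∧ ‖z‖ = 4 / ρ * ‖w‖ ∧ w = z • v := by
    intro w
    rcases eq_or_ne w 0 with rfl | hw
    · exact ⟨0, 0, by simpa using half_pos hρ, by simp, by simp⟩
    have hw' : 0 < ‖w‖ := norm_pos_iff.2 hw
    have hp : 0 < 4 / ρ * ‖w‖ := by positivity
    have hn : ‖((4 / ρ * ‖w‖ : ℝ) : ℂ)‖ = 4 / ρ * ‖w‖ := by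
      rw [Complex.norm_real, Real.norm_eq_abs, abs_of_pos hp]
    have h0 : ((4 / ρ * ‖w‖ : ℝ) : ℂ) ≠ 0 := by
      rw [← norm_ne_zero_iff, hn]; exact hp.ne'
    refine ⟨((4 / ρ * ‖w‖ : ℝ) : ℂ), ((4 / ρ * ‖w‖ : ℝ) : ℂ)⁻¹ • w, ?_, hn, ?_⟩
    · rw [norm_smul, norm_inv, hn]
      have : (4 / ρ * ‖w‖)⁻¹ * ‖w‖ = ρ / 4 := by field_simp
      rw [this]; linarith
    · rw [smul_smul, mul_inv_cancel₀ h0, one_smul]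
  have hx0 : ‖x - x‖ < ρ / 2 := by simpa using half_pos hρ
  let A₀ : X →ₗ[ℂ] ℂ :=
    { toFun := d x
      map_add' := hadd
      map_smul' := fun a v => hhom x v a }
  let A : X →L[ℂ] ℂ := A₀.mkContinuous (2 * C * (4 / ρ)) (by
    intro w
    obtain ⟨z, v, hv, hz, rfl⟩ := hscale w
    change ‖d x (z • v)‖ ≤ _
    rw [hhom, norm_mul]
    have := (est x v hx0 hv 0 (by simp)).2.1
    calc ‖z‖ * ‖d x v‖ ≤ ‖z‖ * (2 * C) := by gcongr
      _ = _ := by rw [hz]; ring)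
  -- Writing `y - x = z • v` with `‖v‖ < ρ / 2` and `‖z‖ = 4 / ρ * ‖y - x‖` makes the line estimate
  -- uniform in the direction.
  have hO : (fun y => F y - F x - A (y - x)) =O[𝓝 x] fun y => ‖y - x‖ ^ 2 := by
    refine Asymptotics.IsBigO.of_bound (4 * C * (4 / ρ) ^ 2) ?_
    filter_upwards [Metric.ball_mem_nhds x (show 0 < ρ / 4 by positivity)] with y hy
    obtain ⟨z, v, hv, hz, hyz⟩ := hscale (y - x)
    rw [mem_ball, dist_eq_norm] at hy
    have hz1 : ‖z‖ < 1 := by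
      rw [hz]
      calc 4 / ρ * ‖y - x‖ < 4 / ρ * (ρ / 4) := by gcongr
        _ = 1 := by field_simp
    have h1 := (est x v hx0 hv z hz1).2.2
    rw [← hyz, add_sub_cancel] at h1
    have h2 : A (y - x) = z * d x v := by
      rw [hyz, map_smul]; rfl
    rw [h2, norm_pow, norm_norm]
    calc _ ≤ _ := h1
      _ = _ := by rw [hz]; ring
  have h1 : HasFDerivAt (fun y => F y - F x - A (y - x)) 0 x := hO.hasFDerivAt (𝕜 := ℂ) one_lt_two
  have h2 : HasFDerivAt (fun y => A (y - x)) A x := by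
    have := A.hasFDerivAt.comp x ((hasFDerivAt_id (𝕜 := ℂ) x).sub_const x)
    simpa [Function.comp_def] using this
  have h3 : DifferentiableAt ℂ (fun y => (F y - F x - A (y - x)) + A (y - x) + F x) x :=
    ((h1.add h2).add_const (F x)).differentiableAt
  simpa using h3

end Gateaux

/-! ### Maps into `ℓ¹` and openness of the domain. -/

/-- The element of `ℓ¹` with the given entries, when these are summable. -/
noncomputable def ofSeq (x : ℕ → ℂ) : Ell1 := ∑' n, lp.single 1 n (x n)

theorem ofSeq_coe (ζ : Ell1) : ofSeq ζ = ζ := (lp.hasSum_single (by simp) ζ).tsum_eq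

theorem summable_norm_ell1 (ζ : Ell1) : Summable fun n => ‖ζ n‖ := by
  have := (lp.memℓp ζ).summable (by simp)
  simpa using this

theorem ofSeq_apply {x : ℕ → ℂ} {u : ℕ → ℝ} (hu : Summable u) (hx : ∀ n, ‖x n‖ ≤ u n) (n : ℕ) :
    ofSeq x n = x n := by
  have hm : Memℓp x 1 := memℓp_gen (by
    simpa using Summable.of_nonneg_of_le (fun n => norm_nonneg (x n)) hx hu)
  exact congrArg (fun ζ : Ell1 => ζ n) (ofSeq_coe ⟨x, hm⟩)

theorem norm_single_ell1 (n : ℕ) (z : ℂ) : ‖(lp.single 1 n z : Ell1)‖ = ‖z‖ :=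
  lp.norm_single (E := fun _ : ℕ => ℂ) zero_lt_one n z

theorem continuous_single_ell1 (n : ℕ) : Continuous fun z : ℂ => (lp.single 1 n z : Ell1) :=
  (lp.singleContinuousLinearMap ℂ (fun _ : ℕ => ℂ) 1 n).continuous

/-- The Weierstrass M-test for the series of single-coordinate vectors; one summable majorant of the
entries controls the `ℓ¹` norm. -/
theorem continuousOn_ofSeq {Y : Type*} [TopologicalSpace Y] {γ : Y → ℕ → ℂ} {s : Set Y} {u : ℕ → ℝ}
    (hu : Summable u) (hγ : ∀ n, ContinuousOn (fun y => γ y n) s)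
    (hle : ∀ n, ∀ y ∈ s, ‖γ y n‖ ≤ u n) : ContinuousOn (fun y => ofSeq (γ y)) s := by
  refine continuousOn_tsum (fun n => (continuous_single_ell1 n).comp_continuousOn (hγ n)) hu ?_
  intro n y hy
  rw [norm_single_ell1]
  exact hle n y hy

theorem differentiableOn_ofSeq {γ : ℂ → ℕ → ℂ} {s : Set ℂ} (hs : IsOpen s) {u : ℕ → ℝ}
    (hu : Summable u) (hγ : ∀ n, DifferentiableOn ℂ (fun z => γ z n) s)
    (hle : ∀ n, ∀ z ∈ s, ‖γ z n‖ ≤ u n) : DifferentiableOn ℂ (fun z => ofSeq (γ z)) s := by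
  refine Complex.differentiableOn_tsum_of_summable_norm hu (fun n => ?_) hs ?_
  · exact (lp.singleContinuousLinearMap ℂ (fun _ : ℕ => ℂ) 1 n).differentiable.comp_differentiableOn
      (hγ n)
  · intro n y hy
    rw [norm_single_ell1]
    exact hle n y hy

theorem tendsto_ofSeq {ι : Type*} {l : Filter ι} {γ : ι → ℕ → ℂ} {x : ℕ → ℂ} {u : ℕ → ℝ}
    (hu : Summable u) (hγ : ∀ n, Tendsto (fun i => γ i n) l (𝓝 (x n)))
    (hle : ∀ i n, ‖γ i n‖ ≤ u n) : Tendsto (fun i => ofSeq (γ i)) l (𝓝 (ofSeq x)) := by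
  refine tendsto_tsum_of_dominated_convergence hu
    (fun n => ((continuous_single_ell1 n).tendsto _).comp (hγ n)) (.of_forall fun i n => ?_)
  rw [norm_single_ell1]
  exact hle i n

/-- The entries tend to zero, so only finitely many can exceed `1 / 2`. This uniform gap makes `D1`
open and the infinite Poisson product converge. -/
theorem exists_norm_le_of_mem_D1 {ζ : Ell1} (hζ : ζ ∈ D1) :
    ∃ s : ℝ, 0 ≤ s ∧ s < 1 ∧ ∀ n, ‖ζ n‖ ≤ s := by
  have ht := (summable_norm_ell1 ζ).tendsto_atTop_zero
  obtain ⟨N, hN⟩ := eventually_atTop.1 (ht.eventually (gt_mem_nhds (show (0 : ℝ) < 1 / 2 by norm_num)))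
  have hfin : ∀ N : ℕ, ∃ s : ℝ, 1 / 2 ≤ s ∧ s < 1 ∧ ∀ n < N, ‖ζ n‖ ≤ s := by
    intro N
    induction N with
    | zero => exact ⟨1 / 2, le_rfl, by norm_num, by simp⟩
    | succ N ih =>
      obtain ⟨s, h1, h2, h3⟩ := ih
      refine ⟨max s ‖ζ N‖, h1.trans (le_max_left _ _), max_lt h2 (hζ N), fun n hn => ?_⟩
      rcases Nat.lt_succ_iff_lt_or_eq.1 hn with h | rfl
      · exact (h3 n h).trans (le_max_left _ _)
      · exact le_max_right _ _
  obtain ⟨s, h1, h2, h3⟩ := hfin N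
  refine ⟨s, by linarith, h2, fun n => ?_⟩
  rcases lt_or_ge n N with h | h
  · exact h3 n h
  · exact (hN n h).le.trans h1

theorem isOpen_D1 : IsOpen D1 := by
  rw [Metric.isOpen_iff]
  intro ζ hζ
  obtain ⟨s, -, h1, h2⟩ := exists_norm_le_of_mem_D1 hζ
  refine ⟨1 - s, by linarith, fun ξ hξ n => ?_⟩
  rw [mem_ball, dist_eq_norm] at hξ
  have h3 : ‖(ξ - ζ : Ell1) n‖ ≤ ‖ξ - ζ‖ := lp.norm_apply_le_norm (by simp) _ n
  have h4 : ‖ξ n‖ ≤ ‖ζ n‖ + ‖(ξ - ζ : Ell1) n‖ := by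
    have : ξ n = ζ n + (ξ - ζ : Ell1) n := by simp
    rw [this]; exact norm_add_le _ _
  linarith [h2 n]

end InfPolydisc

/-! ### Haar measure as a product and the Poisson kernel of the infinite polydisc. -/

namespace InfPolydisc

open Metric

theorem map_mul_left_infinitePi_circleMeasure (w : Torus) :
    (Measure.infinitePi fun _ : ℕ => circleMeasure).map (fun x => w * x) =
      Measure.infinitePi fun _ : ℕ => circleMeasure := by
  have := Measure.infinitePi_map_pi (fun _ : ℕ => circleMeasure)
    (f := fun n (c : Circle) => w n * c) fun n => (continuous_const_mul (w n)).measurable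
  simp_rw [map_mul_left_circleMeasure] at this
  exact this

/-- The product of arc lengths is a translation-invariant probability measure, so uniqueness of Haar
measure applies. -/
theorem mInf_eq_infinitePi : mInf = Measure.infinitePi fun _ : ℕ => circleMeasure := by
  have : (Measure.infinitePi fun _ : ℕ => circleMeasure : Measure Torus).IsMulLeftInvariant :=
    ⟨map_mul_left_infinitePi_circleMeasure⟩
  have h := Measure.haarMeasure_unique (Measure.infinitePi fun _ : ℕ => circleMeasure : Measure Torus)
    (⊤ : TopologicalSpace.PositiveCompacts Torus)
  rw [TopologicalSpace.PositiveCompacts.coe_top, measure_univ, one_smul] at h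
  exact h.symm

instance : IsProbabilityMeasure mInf := by
  rw [mInf_eq_infinitePi]; infer_instance

instance : mInf.IsMulLeftInvariant := Measure.isMulLeftInvariant_haarMeasure _

section Poisson

variable {ζ : Ell1}

/-- From `1 - |a| ≤ |c - a| ≤ 1 + |a|` the kernel lies between `(1 - |a|) / (1 + |a|)` and its
inverse. Linearity in `|a|` makes the deviations summable over the coordinates of a point of `D1`.
-/
theorem abs_poissonKernel_sub_one_le {a : ℂ} {s : ℝ} (hs : s < 1) (ha : ‖a‖ ≤ s) (c : Circle) :
    |poissonKernel 0 a c - 1| ≤ 2 / (1 - s) * ‖a‖ := by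
  have h0 := norm_nonneg a
  have h1 : 1 - ‖a‖ ≤ ‖(c : ℂ) - a‖ := by
    have := norm_sub_norm_le (c : ℂ) a
    rwa [Circle.norm_coe] at this
  have h2 : ‖(c : ℂ) - a‖ ≤ 1 + ‖a‖ := by
    have := norm_sub_le (c : ℂ) a
    rwa [Circle.norm_coe] at this
  have hpos : 0 < 1 - ‖a‖ := by linarith
  have hd : 0 < ‖(c : ℂ) - a‖ := by linarith
  rw [poissonKernel_def]
  simp only [sub_zero, Circle.norm_coe]
  have hup : (1 ^ 2 - ‖a‖ ^ 2) / ‖(c : ℂ) - a‖ ^ 2 ≤ 1 + 2 / (1 - ‖a‖) * ‖a‖ := by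
    have : 1 + 2 / (1 - ‖a‖) * ‖a‖ = (1 ^ 2 - ‖a‖ ^ 2) / (1 - ‖a‖) ^ 2 := by
      field_simp; ring
    rw [this]
    have : 0 ≤ 1 ^ 2 - ‖a‖ ^ 2 := by nlinarith
    gcongr
  have hlo : 1 - 2 / (1 - ‖a‖) * ‖a‖ ≤ (1 ^ 2 - ‖a‖ ^ 2) / ‖(c : ℂ) - a‖ ^ 2 := by
    have e1 : (1 - ‖a‖) / (1 + ‖a‖) ≤ (1 ^ 2 - ‖a‖ ^ 2) / ‖(c : ℂ) - a‖ ^ 2 := by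
      have : (1 - ‖a‖) / (1 + ‖a‖) = (1 ^ 2 - ‖a‖ ^ 2) / (1 + ‖a‖) ^ 2 := by
        field_simp; ring
      rw [this]
      have : 0 ≤ 1 ^ 2 - ‖a‖ ^ 2 := by nlinarith
      gcongr
    refine le_trans ?_ e1
    rw [le_div_iff₀ (by linarith)]
    have : 2 / (1 - ‖a‖) * ‖a‖ * (1 + ‖a‖) ≥ 2 * ‖a‖ := by
      rw [ge_iff_le, div_mul_eq_mul_div, div_mul_eq_mul_div, le_div_iff₀ hpos]
      nlinarith [mul_nonneg h0 h0]
    linarith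
  have hmono : 2 / (1 - ‖a‖) * ‖a‖ ≤ 2 / (1 - s) * ‖a‖ := by
    have : 0 < 1 - s := by linarith
    gcongr
  rw [abs_le]
  constructor <;> linarith

/-- The finite products of Poisson kernels converge to the Poisson kernel of `D1`, and stay
bounded. -/
theorem tendsto_prod_poissonKernel (hζ : ζ ∈ D1) : ∃ B : ℝ, ∀ w : Torus,
    Tendsto (fun N => ∏ n ∈ Finset.range N, poissonKernel 0 (ζ n) (w n)) atTop
      (𝓝 (poisson ζ w)) ∧
    ∀ N, ∏ n ∈ Finset.range N, poissonKernel 0 (ζ n) (w n) ≤ B := by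
  obtain ⟨s, hs0, hs1, hs⟩ := exists_norm_le_of_mem_D1 hζ
  have hsum : Summable fun n => 2 / (1 - s) * ‖ζ n‖ := (summable_norm_ell1 ζ).mul_left _
  refine ⟨Real.exp (∑' n, 2 / (1 - s) * ‖ζ n‖), fun w => ⟨?_, fun N => ?_⟩⟩
  · have hm : Multipliable fun n => 1 + (poissonKernel 0 (ζ n) (w n) - 1) :=
      Real.multipliable_one_add_of_summable (Summable.of_norm_bounded hsum fun n =>
        abs_poissonKernel_sub_one_le hs1 (hs n) (w n))
    simp only [add_sub_cancel] at hm
    exact hm.tendsto_prod_tprod_nat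
  · have h1s : 0 < 1 - s := by linarith
    calc ∏ n ∈ Finset.range N, poissonKernel 0 (ζ n) (w n)
        ≤ ∏ n ∈ Finset.range N, Real.exp (2 / (1 - s) * ‖ζ n‖) := by
          refine Finset.prod_le_prod (fun n _ => poissonKernel_circle_nonneg (hζ n) _) fun n _ => ?_
          have h1 := (abs_le.1 (abs_poissonKernel_sub_one_le hs1 (hs n) (w n))).2
          have h2 := Real.add_one_le_exp (2 / (1 - s) * ‖ζ n‖)
          linarith
      _ = Real.exp (∑ n ∈ Finset.range N, 2 / (1 - s) * ‖ζ n‖) := (Real.exp_sum _ _).symm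
      _ ≤ _ := Real.exp_le_exp.2 (hsum.sum_le_tsum _ fun n _ => by positivity)

theorem poisson_nonneg (hζ : ζ ∈ D1) (w : Torus) : 0 ≤ poisson ζ w := by
  obtain ⟨B, hB⟩ := tendsto_prod_poissonKernel hζ
  exact ge_of_tendsto' (hB w).1 fun N =>
    Finset.prod_nonneg fun n _ => poissonKernel_circle_nonneg (hζ n) _

theorem exists_poisson_le (hζ : ζ ∈ D1) : ∃ B : ℝ, ∀ w, poisson ζ w ≤ B := by
  obtain ⟨B, hB⟩ := tendsto_prod_poissonKernel hζ
  exact ⟨B, fun w => le_of_tendsto' (hB w).1 (hB w).2⟩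

theorem measurable_poissonKernel_eval (hζ : ζ ∈ D1) (n : ℕ) :
    Measurable fun w : Torus => poissonKernel 0 (ζ n) (w n) :=
  ((continuous_poissonKernel_circle (hζ n)).comp (continuous_apply n)).measurable

theorem measurable_poisson (hζ : ζ ∈ D1) : Measurable (poisson ζ) := by
  obtain ⟨B, hB⟩ := tendsto_prod_poissonKernel hζ
  refine measurable_of_tendsto_metrizable
    (f := fun N (w : Torus) => ∏ n ∈ Finset.range N, poissonKernel 0 (ζ n) (w n)) (fun N => ?_)
    (tendsto_pi_nhds.2 fun w => (hB w).1)
  exact Finset.measurable_fun_prod _ fun n _ => measurable_poissonKernel_eval hζ n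

/-- The coordinatewise action of disk automorphisms on the torus. -/
noncomputable def mobiusTorus (hζ : ζ ∈ D1) (w : Torus) : Torus :=
  fun n => mobiusCircle (hζ n) (w n)

theorem continuous_mobiusTorus (hζ : ζ ∈ D1) : Continuous (mobiusTorus hζ) :=
  continuous_pi fun n => (continuous_mobiusCircle (hζ n)).comp (continuous_apply n)

/-- A product measure is determined on finite boxes. There the density is a bounded limit of finite
products, whose integrals split by independence; coordinates outside the box contribute mass 1. -/
theorem map_mobiusTorus (hζ : ζ ∈ D1) :
    mInf.map (mobiusTorus hζ) = mInf.withDensity fun w => ENNReal.ofReal (poisson ζ w) := by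
  classical
  have hprob : ∀ n, IsProbabilityMeasure (circleMeasure.map (mobiusCircle (hζ n))) := fun n =>
    Measure.isProbabilityMeasure_map (continuous_mobiusCircle (hζ n)).aemeasurable
  have e1 : mInf.map (mobiusTorus hζ) =
      Measure.infinitePi fun n => circleMeasure.map (mobiusCircle (hζ n)) := by
    rw [mInf_eq_infinitePi]
    exact Measure.infinitePi_map_pi (fun _ : ℕ => circleMeasure)
      (f := fun n => mobiusCircle (hζ n)) fun n => (continuous_mobiusCircle (hζ n)).measurable
  rw [e1]
  refine (Measure.eq_infinitePi _ fun s t ht => ?_).symm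
  obtain ⟨B, hB⟩ := tendsto_prod_poissonKernel hζ
  -- The box is padded by the full circle, so that every coordinate below `N` contributes a factor
  -- of the same form.
  let t' : ℕ → Set Circle := fun i => if i ∈ s then t i else univ
  have ht' : ∀ i, MeasurableSet (t' i) := fun i => by
    by_cases h : i ∈ s <;> simp [t', h, ht i]
  have hpi : MeasurableSet ((s : Set ℕ).pi t) := .pi s.countable_toSet fun i _ => ht i
  let X : ℕ → Circle → ℝ≥0∞ := fun i =>
    (t' i).indicator fun c => ENNReal.ofReal (poissonKernel 0 (ζ i) c)
  have hXm : ∀ i, Measurable (X i) := fun i =>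
    ((continuous_poissonKernel_circle (hζ i)).measurable.ennreal_ofReal).indicator (ht' i)
  have hXi : ∀ i, ∫⁻ w : Torus, X i (w i) ∂mInf =
      circleMeasure.map (mobiusCircle (hζ i)) (t' i) := by
    intro i
    rw [mInf_eq_infinitePi, (measurePreserving_eval_infinitePi (fun _ : ℕ => circleMeasure)
      i).lintegral_comp (hXm i), map_mobiusCircle, withDensity_apply _ (ht' i),
      ← lintegral_indicator (ht' i)]
  obtain ⟨N₀, hN₀⟩ : ∃ N₀, ∀ N ≥ N₀, s ⊆ Finset.range N := by
    refine ⟨s.sup id + 1, fun N hN i hi => ?_⟩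
    have : i ≤ s.sup id := Finset.le_sup (f := id) hi
    exact Finset.mem_range.2 (by omega)
  have hprod : ∀ N ≥ N₀, ∀ w : Torus, ∏ i ∈ Finset.range N, X i (w i) =
      ((s : Set ℕ).pi t).indicator (fun w => ENNReal.ofReal
        (∏ n ∈ Finset.range N, poissonKernel 0 (ζ n) (w n))) w := by
    intro N hN w
    by_cases hw : w ∈ (s : Set ℕ).pi t
    · rw [indicator_of_mem hw, ENNReal.ofReal_prod_of_nonneg fun n _ =>
        poissonKernel_circle_nonneg (hζ n) _]
      refine Finset.prod_congr rfl fun i _ => ?_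
      have : w i ∈ t' i := by
        by_cases h : i ∈ s
        · simpa [t', h] using hw i h
        · simp [t', h]
      exact indicator_of_mem this _
    · rw [indicator_of_notMem hw]
      simp only [Set.mem_pi, Finset.mem_coe, not_forall] at hw
      obtain ⟨i, hi, hwi⟩ := hw
      refine Finset.prod_eq_zero (hN₀ N hN hi) ?_
      have : w i ∉ t' i := by simpa [t', hi] using hwi
      exact indicator_of_notMem this _
  have hval : ∀ N ≥ N₀, ∫⁻ w : Torus, ∏ i ∈ Finset.range N, X i (w i) ∂mInf =
      ∏ i ∈ s, circleMeasure.map (mobiusCircle (hζ i)) (t i) := by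
    intro N hN
    have hind : ProbabilityTheory.iIndepFun (fun i (w : Torus) => X i (w i)) mInf := by
      rw [mInf_eq_infinitePi]
      exact ProbabilityTheory.iIndepFun_infinitePi hXm
    rw [ProbabilityTheory.lintegral_prod_eq_prod_lintegral_of_indepFun _ _ hind
      fun i => (hXm i).comp (measurable_pi_apply i)]
    simp_rw [hXi]
    rw [← Finset.prod_subset (hN₀ N hN)]
    · refine Finset.prod_congr rfl fun i hi => ?_
      simp [t', hi]
    · intro i _ hi
      simp [t', hi]
  rw [withDensity_apply _ hpi, ← lintegral_indicator hpi]
  have hlim : Tendsto (fun N => ∫⁻ w : Torus, ((s : Set ℕ).pi t).indicator (fun w => ENNReal.ofReal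
      (∏ n ∈ Finset.range N, poissonKernel 0 (ζ n) (w n))) w ∂mInf) atTop
      (𝓝 (∫⁻ w : Torus, ((s : Set ℕ).pi t).indicator
        (fun w => ENNReal.ofReal (poisson ζ w)) w ∂mInf)) := by
    refine tendsto_lintegral_of_dominated_convergence (fun _ => ENNReal.ofReal B) ?_ ?_ ?_ ?_
    · intro N
      exact (Finset.measurable_fun_prod _ fun n _ =>
        measurable_poissonKernel_eval hζ n).ennreal_ofReal.indicator hpi
    · intro N
      refine .of_forall fun w => ?_
      refine (indicator_le_self' (fun _ _ => zero_le) w).trans ?_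
      exact ENNReal.ofReal_le_ofReal ((hB w).2 N)
    · simp
    · refine .of_forall fun w => ?_
      by_cases hw : w ∈ (s : Set ℕ).pi t
      · simp only [indicator_of_mem hw]
        exact ENNReal.tendsto_ofReal (hB w).1
      · simp only [indicator_of_notMem hw]
        exact tendsto_const_nhds
  refine tendsto_nhds_unique hlim (tendsto_const_nhds.congr' ?_)
  filter_upwards [eventually_ge_atTop N₀] with N hN
  rw [← hval N hN]
  exact lintegral_congr (hprod N hN)

theorem lintegral_comp_mobiusTorus (hζ : ζ ∈ D1) {g : Torus → ℝ≥0∞} (hg : Measurable g) :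
    ∫⁻ w, g (mobiusTorus hζ w) ∂mInf = ∫⁻ w, ENNReal.ofReal (poisson ζ w) * g w ∂mInf := by
  rw [← lintegral_map hg (continuous_mobiusTorus hζ).measurable, map_mobiusTorus,
    lintegral_withDensity_eq_lintegral_mul _ (measurable_poisson hζ).ennreal_ofReal hg]
  rfl

theorem lintegral_poisson (hζ : ζ ∈ D1) : ∫⁻ w, ENNReal.ofReal (poisson ζ w) ∂mInf = 1 := by
  have := lintegral_comp_mobiusTorus hζ (g := fun _ => 1) measurable_const
  simpa using this.symm

end Poisson

/-- Averaging over the rotations along a curve in the torus does not change the integral. -/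
theorem lintegral_lintegral_rotate {τ : Circle → Torus} (hτ : Continuous τ) {g : Torus → ℝ≥0∞}
    (hg : Measurable g) :
    ∫⁻ w, ∫⁻ c, g (τ c * w) ∂circleMeasure ∂mInf = ∫⁻ w, g w ∂mInf := by
  have hm : Measurable fun p : Torus × Circle => g (τ p.2 * p.1) :=
    hg.comp (Continuous.measurable (by fun_prop))
  rw [lintegral_lintegral_swap hm.aemeasurable]
  simp_rw [lintegral_mul_left_eq_self (μ := mInf) g]
  simp

/-- Each factor depends only on `|v w - r^(n+1) w| = |v - r^(n+1)|`. Hence the Poisson integral at a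
dilated torus point is an average of translates against one fixed kernel. -/
theorem poisson_dilate_mul {r : ℝ} (hr : |r| < 1) (w v : Torus) :
    poisson (dilate r w) (v * w) = poisson (dilate r 1) v := by
  unfold poisson
  congr 1
  ext n
  rw [dilate_apply hr, dilate_apply hr, poissonKernel_def, poissonKernel_def]
  have e : (((v * w) n : Circle) : ℂ) - (r : ℂ) ^ (n + 1) * (w n : ℂ) =
      ((v n : ℂ) - (r : ℂ) ^ (n + 1)) * (w n : ℂ) := by
    rw [Pi.mul_apply, Circle.coe_mul]; ring
  simp only [sub_zero, e]
  simp [Circle.norm_coe]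

end InfPolydisc

/-! ### Slices, radial limits on the torus and the Poisson majorant. -/

namespace InfPolydisc

open Metric Real

variable {F : Ell1 → ℂ}

theorem summable_pow_succ {r : ℝ} (h0 : 0 ≤ r) (h1 : r < 1) : Summable fun n : ℕ => r ^ (n + 1) :=
  (summable_nat_add_iff 1).2 (summable_geometric_of_lt_one h0 h1)

theorem dilate_eq_ofSeq {r : ℝ} (hr : |r| < 1) (w : Torus) :
    dilate r w = ofSeq fun n => (r : ℂ) ^ (n + 1) * (w n : ℂ) := by
  rw [← ofSeq_coe (dilate r w)]
  congr 1
  ext n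
  exact dilate_apply hr w n

theorem norm_pow_mul_le {r : ℝ} (h0 : 0 ≤ r) {x : ℂ} (hx : ‖x‖ ≤ 1) (n : ℕ) :
    ‖(r : ℂ) ^ (n + 1) * x‖ ≤ r ^ (n + 1) := by
  rw [norm_mul, norm_pow, Complex.norm_real, Real.norm_eq_abs, abs_of_nonneg h0]
  exact mul_le_of_le_one_right (by positivity) hx

theorem ofSeq_pow_mul_mem_D1 {r : ℝ} (h0 : 0 ≤ r) (h1 : r < 1) {x : ℕ → ℂ} (hx : ∀ n, ‖x n‖ ≤ 1) :
    ofSeq (fun n => (r : ℂ) ^ (n + 1) * x n) ∈ D1 := by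
  intro n
  rw [ofSeq_apply (summable_pow_succ h0 h1) fun n => norm_pow_mul_le h0 (hx n) n]
  exact (norm_pow_mul_le h0 (hx n) n).trans_lt (pow_lt_one₀ h0 h1 n.succ_ne_zero)

theorem continuous_dilate {r : ℝ} (h0 : 0 ≤ r) (h1 : r < 1) : Continuous (dilate r) := by
  have hr : |r| < 1 := by rwa [abs_of_nonneg h0]
  have h : dilate r = fun w => ofSeq fun n => (r : ℂ) ^ (n + 1) * (w n : ℂ) :=
    funext (dilate_eq_ofSeq hr)
  rw [h, ← continuousOn_univ]
  refine continuousOn_ofSeq (summable_pow_succ h0 h1) (fun n => ?_)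
    fun n w _ => norm_pow_mul_le h0 (w n).norm_coe.le n
  have : Continuous fun w : Torus => (w n : ℂ) := continuous_coe_circle.comp (continuous_apply n)
  exact (this.const_mul _).continuousOn

theorem continuous_slice (hF : IsHolomorphicOn F D1) {r : ℝ} (hr : r ∈ Ioo (0 : ℝ) 1) :
    Continuous (slice F r) := by
  refine continuous_iff_continuousAt.2 fun w => ?_
  have hm : dilate r w ∈ D1 := dilate_mem_D1 (by rw [abs_of_pos hr.1]; exact hr.2) w
  exact (hF.differentiableAt isOpen_D1 hm).continuousAt.comp
    (continuous_dilate hr.1.le hr.2).continuousAt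

/-- The curve of powers in the torus. -/
noncomputable def powers (c : Circle) : Torus := fun n => c ^ (n + 1)

theorem continuous_powers : Continuous powers := continuous_pi fun n => continuous_pow (n + 1)

/-- The restriction of `F` to the analytic disk `z ↦ (z w₁, z² w₂, …)`. -/
noncomputable def diskFunction (F : Ell1 → ℂ) (w : Torus) (z : ℂ) : ℂ :=
  F (ofSeq fun n => z ^ (n + 1) * (w n : ℂ))

theorem diskFunction_mul (F : Ell1 → ℂ) (w : Torus) {r : ℝ} (hr : r ∈ Ioo (0 : ℝ) 1) (c : Circle) :
    diskFunction F w (r * c) = slice F r (powers c * w) := by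
  have hr' : |r| < 1 := by rw [abs_of_pos hr.1]; exact hr.2
  rw [slice, dilate_eq_ofSeq hr', diskFunction]
  congr 2
  ext n
  rw [Pi.mul_apply, powers, Circle.coe_mul, Circle.coe_pow]
  ring

theorem differentiableOn_diskFunction (hF : IsHolomorphicOn F D1) (w : Torus) :
    DifferentiableOn ℂ (diskFunction F w) (ball 0 1) := by
  intro z hz
  have hz1 : ‖z‖ < 1 := by simpa using hz
  obtain ⟨R, hzR, hR1⟩ := exists_between hz1
  have hR0 : 0 ≤ R := (norm_nonneg z).trans hzR.le
  have hle : ∀ n, ∀ z ∈ ball (0 : ℂ) R, ‖z ^ (n + 1) * (w n : ℂ)‖ ≤ R ^ (n + 1) := by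
    intro n z hz
    rw [norm_mul, Circle.norm_coe, mul_one, norm_pow]
    rw [mem_ball_zero_iff] at hz
    gcongr
  have hd : DifferentiableOn ℂ (fun z => ofSeq fun n => z ^ (n + 1) * (w n : ℂ)) (ball 0 R) :=
    differentiableOn_ofSeq isOpen_ball (summable_pow_succ hR0 hR1) (fun n => by fun_prop) hle
  have hzb : z ∈ ball (0 : ℂ) R := by simpa using hzR
  have hm : ofSeq (fun n => z ^ (n + 1) * (w n : ℂ)) ∈ D1 := by
    intro n
    rw [ofSeq_apply (summable_pow_succ hR0 hR1) fun n => hle n z hzb]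
    exact (hle n z hzb).trans_lt (pow_lt_one₀ hR0 hR1 n.succ_ne_zero)
  have := (hF.differentiableAt isOpen_D1 hm).comp z (hd.differentiableAt (isOpen_ball.mem_nhds hzb))
  exact this.differentiableWithinAt

theorem continuousOn_slice (hF : IsHolomorphicOn F D1) (w : Torus) :
    ContinuousOn (fun r => slice F r w) (Ioo 0 1) := by
  have h : ContinuousOn (fun r : ℝ => diskFunction F w (r * (1 : Circle))) (Ioo 0 1) :=
    (differentiableOn_diskFunction hF w).continuousOn.comp (by fun_prop)
      fun r hr => mul_coe_circle_mem_ball hr 1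
  refine h.congr fun r hr => ?_
  simp only [diskFunction_mul F w hr]
  congr 1
  ext n
  simp [powers]

theorem measurableSet_exists_limit_slice (hF : IsHolomorphicOn F D1) :
    MeasurableSet {w : Torus | ∃ l, Tendsto (fun r => slice F r w) (𝓝[<] 1) (𝓝 l)} :=
  measurableSet_exists_tendsto_nhdsLT_one (fun _ hr => (continuous_slice hF hr).measurable)
    (continuousOn_slice hF)

theorem exists_seq_Ioo_tendsto_one : ∃ u : ℕ → ℝ, (∀ n, u n ∈ Ioo (0 : ℝ) 1) ∧
    Tendsto u atTop (𝓝 1) ∧ Tendsto u atTop (𝓝[<] 1) := by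
  obtain ⟨u, -, hu, hut⟩ := exists_seq_strictMono_tendsto' (zero_lt_one' ℝ)
  exact ⟨u, hu, hut, tendsto_nhdsWithin_iff.2 ⟨hut, .of_forall fun n => (hu n).2⟩⟩

theorem continuous_posLog_slice (hF : IsHolomorphicOn F D1) {r : ℝ} (hr : r ∈ Ioo (0 : ℝ) 1) :
    Continuous fun w => posLog ‖slice F r w‖ :=
  continuous_posLog.comp (continuous_slice hF hr).norm

theorem measurable_posLog_slice (hF : IsHolomorphicOn F D1) {r : ℝ} (hr : r ∈ Ioo (0 : ℝ) 1) :
    Measurable fun w => ENNReal.ofReal (posLog ‖slice F r w‖) :=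
  (continuous_posLog_slice hF hr).measurable.ennreal_ofReal

theorem ofReal_circleAverage {f : ℂ → ℝ} (hf : ContinuousOn f (sphere 0 1)) (h0 : ∀ z, 0 ≤ f z) :
    ENNReal.ofReal (circleAverage f 0 1) =
      ∫⁻ c : Circle, ENNReal.ofReal (f c) ∂circleMeasure := by
  rw [← integral_circleMeasure hf]
  exact ofReal_integral_eq_lintegral_ofReal (integrable_of_continuous_circle
    (hf.comp_continuous continuous_coe_circle coe_circle_mem_sphere)) (.of_forall fun _ => h0 _)

/-- Functions of the Nevanlinna class have radial limits almost everywhere. -/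
theorem Nevanlinna.ae_exists_limit (hF : Nevanlinna F) :
    ∀ᵐ w ∂mInf, ∃ l : ℂ, Tendsto (fun r : ℝ => slice F r w) (𝓝[<] (1 : ℝ)) (𝓝 l) := by
  obtain ⟨u, hu, hut, -⟩ := exists_seq_Ioo_tendsto_one
  obtain ⟨hFh, hS⟩ := hF
  set S := ⨆ r ∈ Ioo (0 : ℝ) 1, ∫⁻ w, ENNReal.ofReal (posLog ‖slice F r w‖) ∂mInf
  let I : ℕ → Torus → ℝ≥0∞ := fun n w =>
    ∫⁻ c, ENNReal.ofReal (posLog ‖slice F (u n) (powers c * w)‖) ∂circleMeasure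
  have hIm : ∀ n, Measurable (I n) := fun n => by
    refine Measurable.lintegral_prod_right'
      (f := fun p : Torus × Circle => ENNReal.ofReal (posLog ‖slice F (u n) (powers p.2 * p.1)‖)) ?_
    have hc : Continuous fun p : Torus × Circle => powers p.2 * p.1 :=
      (continuous_powers.comp continuous_snd).mul continuous_fst
    exact (measurable_posLog_slice hFh (hu n)).comp hc.measurable
  have hI : ∀ n, ∫⁻ w, I n w ∂mInf ≤ S := fun n => by
    rw [lintegral_lintegral_rotate continuous_powers (measurable_posLog_slice hFh (hu n))]
    exact le_iSup₂ (f := fun r (_ : r ∈ Ioo (0 : ℝ) 1) =>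
      ∫⁻ w, ENNReal.ofReal (posLog ‖slice F r w‖) ∂mInf) (u n) (hu n)
  -- Fatou's lemma, where the rotation average of each `I n` is at most the Nevanlinna supremum.
  have hlim : ∫⁻ w, liminf (fun n => I n w) atTop ∂mInf < ∞ := by
    refine (lintegral_liminf_le hIm).trans_lt (lt_of_le_of_lt ?_ hS)
    exact liminf_le_of_frequently_le' (Frequently.of_forall hI)
  have hae := ae_lt_top (Measurable.liminf hIm) hlim.ne
  have hae2 : ∀ᵐ w ∂mInf, ∀ᵐ c ∂circleMeasure,
      ∃ l : ℂ, Tendsto (fun r : ℝ => slice F r (powers c * w)) (𝓝[<] (1 : ℝ)) (𝓝 l) := by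
    filter_upwards [hae] with w hw
    -- A finite `liminf` bounds the circle means only for infinitely many `n`, depending on `w`;
    -- this is why the disk theorem asks for the bound only frequently.
    obtain ⟨C, hC1, hC2⟩ := ENNReal.lt_iff_exists_nnreal_btwn.1 hw
    have hfr := frequently_lt_of_liminf_lt (by isBoundedDefault) hC1
    have hdf := differentiableOn_diskFunction hFh w
    have hfr2 : ∃ᶠ n in atTop,
        circleAverage (fun z => posLog ‖diskFunction F w (u n * z)‖) 0 1 ≤ C := by
      refine hfr.mono fun n hn => ?_
      have hcs : ContinuousOn (fun z => posLog ‖diskFunction F w (u n * z)‖) (sphere 0 1) := by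
        have hc := (diffContOnCl_comp_mul hdf (hu n)).continuousOn
        rw [closure_ball 0 one_ne_zero] at hc
        exact continuous_posLog.comp_continuousOn (hc.mono sphere_subset_closedBall).norm
      have h1 := ofReal_circleAverage hcs fun _ => posLog_nonneg
      simp_rw [diskFunction_mul F w (hu n)] at h1
      have h2 : ENNReal.ofReal (circleAverage
          (fun z => posLog ‖diskFunction F w (u n * z)‖) 0 1) ≤ C := h1.trans_le hn.le
      rw [← ENNReal.ofReal_coe_nnreal] at h2
      exact (ENNReal.ofReal_le_ofReal_iff C.2).1 h2
    filter_upwards [ae_exists_radialLimit hdf hu hut hfr2] with c ⟨l, hl⟩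
    refine ⟨l, hl.congr' ?_⟩
    filter_upwards [Ioo_mem_nhdsLT (zero_lt_one' ℝ)] with r hr
    exact diskFunction_mul F w hr c
  have hMS := measurableSet_exists_limit_slice hFh
  set L := {w : Torus | ∃ l, Tendsto (fun r => slice F r w) (𝓝[<] 1) (𝓝 l)}
  -- The limit exists at `powers c * w` for almost every `c`, not at `w` itself; averaging the
  -- indicator of the bad set over these rotations shows that the set is null.
  have h0 : mInf Lᶜ = 0 := by
    rw [← lintegral_indicator_one hMS.compl, ← lintegral_lintegral_rotate continuous_powers
      (measurable_one.indicator hMS.compl)]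
    rw [lintegral_eq_zero_of_ae_eq_zero]
    filter_upwards [hae2] with w hw
    refine lintegral_eq_zero_of_ae_eq_zero ?_
    filter_upwards [hw] with c hc
    have hn : powers c * w ∉ Lᶜ := fun h => h hc
    exact indicator_of_notMem hn _
  exact h0

/-- `log⁺ |F|` is dominated by the Poisson integral of its values on a smaller torus. -/
theorem posLog_le_lintegral_poisson (hF : IsHolomorphicOn F D1) {ζ : Ell1} (hζ : ζ ∈ D1) {r : ℝ}
    (hr : r ∈ Ioo (0 : ℝ) 1) :
    ENNReal.ofReal (posLog ‖F (ofSeq fun n => (r : ℂ) ^ (n + 1) * ζ n)‖) ≤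
      ∫⁻ w, ENNReal.ofReal (poisson ζ w) * ENNReal.ofReal (posLog ‖slice F r w‖) ∂mInf := by
  have hr' : |r| < 1 := by rw [abs_of_pos hr.1]; exact hr.2
  -- After the change of variables by `mobiusTorus`, an average over diagonal rotations is inserted,
  -- so that for each `w` a one-variable mean inequality can be used.
  rw [← lintegral_comp_mobiusTorus hζ (measurable_posLog_slice hF hr),
    ← lintegral_lintegral_rotate (τ := fun c _ => c) (by fun_prop)
      (g := fun w => ENNReal.ofReal (posLog ‖slice F r (mobiusTorus hζ w)‖))
      ((measurable_posLog_slice hF hr).comp (continuous_mobiusTorus hζ).measurable)]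
  have hpt : ∀ w : Torus, ENNReal.ofReal (posLog ‖F (ofSeq fun n => (r : ℂ) ^ (n + 1) * ζ n)‖) ≤
      ∫⁻ c : Circle, ENNReal.ofReal (posLog ‖slice F r (mobiusTorus hζ ((fun _ => c) * w))‖)
        ∂circleMeasure := by
    intro w
    -- This disk has the dilate of `ζ` as its centre, and its boundary lies on the torus of radii
    -- `r^(n+1)`.
    let γ : ℂ → ℕ → ℂ := fun z n => (r : ℂ) ^ (n + 1) * mobius (ζ n) (z * w n)
    have hb : ∀ z ∈ closedBall (0 : ℂ) 1, ∀ n, z * (w n : ℂ) ∈ closedBall (0 : ℂ) 1 := by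
      intro z hz n
      simpa [Circle.norm_coe] using hz
    have hle1 : ∀ z ∈ closedBall (0 : ℂ) 1, ∀ n, ‖mobius (ζ n) (z * w n)‖ ≤ 1 := fun z hz n =>
      norm_mobius_le_one (hζ n) (mem_closedBall_zero_iff.1 (hb z hz n))
    have hγd : ∀ n, DifferentiableOn ℂ (fun z => γ z n) (closedBall 0 1) := fun n =>
      ((differentiableOn_mobius (hζ n)).comp (by fun_prop) fun z hz => hb z hz n).const_mul _
    have hmem : ∀ z ∈ closedBall (0 : ℂ) 1, ofSeq (γ z) ∈ D1 := fun z hz =>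
      ofSeq_pow_mul_mem_D1 hr.1.le hr.2 (hle1 z hz)
    have hh : DiffContOnCl ℂ (fun z => F (ofSeq (γ z))) (ball 0 1) := by
      constructor
      · have hd : DifferentiableOn ℂ (fun z => ofSeq (γ z)) (ball 0 1) :=
          differentiableOn_ofSeq isOpen_ball (summable_pow_succ hr.1.le hr.2)
            (fun n => (hγd n).mono ball_subset_closedBall)
            fun n z hz => norm_pow_mul_le hr.1.le (hle1 z (ball_subset_closedBall hz) n) n
        intro z hz
        exact (hF.differentiableAt isOpen_D1
          (hmem z (ball_subset_closedBall hz))).comp_differentiableWithinAt z (hd z hz)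
      · rw [closure_ball 0 one_ne_zero]
        have hc : ContinuousOn (fun z => ofSeq (γ z)) (closedBall 0 1) :=
          continuousOn_ofSeq (summable_pow_succ hr.1.le hr.2)
            (fun n => (hγd n).continuousOn) fun n z hz => norm_pow_mul_le hr.1.le (hle1 z hz n) n
        intro z hz
        exact ContinuousAt.comp_continuousWithinAt (f := fun z => ofSeq (γ z))
          (hF.differentiableAt isOpen_D1 (hmem z hz)).continuousAt (hc z hz)
    have hJ := posLog_norm_le_circleAverage hh
    have hcs : ContinuousOn (fun z => posLog ‖F (ofSeq (γ z))‖) (sphere 0 1) := by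
      have hc := hh.continuousOn
      rw [closure_ball 0 one_ne_zero] at hc
      exact continuous_posLog.comp_continuousOn (hc.mono sphere_subset_closedBall).norm
    have h0 : γ 0 = fun n => (r : ℂ) ^ (n + 1) * ζ n := by
      ext n; simp [γ, mobius_zero]
    rw [h0] at hJ
    refine (ENNReal.ofReal_le_ofReal hJ).trans_eq ?_
    rw [ofReal_circleAverage hcs fun _ => posLog_nonneg]
    refine lintegral_congr fun c => ?_
    rw [slice, dilate_eq_ofSeq hr']
    rfl
  calc ENNReal.ofReal (posLog ‖F (ofSeq fun n => (r : ℂ) ^ (n + 1) * ζ n)‖)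
      = ∫⁻ _ : Torus, ENNReal.ofReal (posLog ‖F (ofSeq fun n => (r : ℂ) ^ (n + 1) * ζ n)‖)
          ∂mInf := by simp
    _ ≤ _ := lintegral_mono hpt

end InfPolydisc

/-! ### Extended logarithms and the characterization of the Smirnov class. -/

namespace InfPolydisc

open Metric Real

section LogAbs

theorem logAbs_of_ne_zero {z : ℂ} (hz : z ≠ 0) : logAbs z = (Real.log ‖z‖ : EReal) := by
  rw [logAbs, ← ofReal_norm, ENNReal.log_ofReal_of_pos (norm_pos_iff.2 hz)]

theorem logAbs_zero : logAbs 0 = ⊥ := by simp [logAbs]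

theorem toENNReal_logAbs (z : ℂ) : (logAbs z).toENNReal = ENNReal.ofReal (posLog ‖z‖) := by
  rcases eq_or_ne z 0 with rfl | hz
  · simp [logAbs_zero]
  · rw [logAbs_of_ne_zero hz, EReal.real_coe_toENNReal, posLog_apply, ENNReal.ofReal_max]
    simp

/-- The negative part of `log |z|`, with value `∞` at `z = 0`. -/
noncomputable def negLog (z : ℂ) : ℝ≥0∞ := (-logAbs z).toENNReal

theorem negLog_zero : negLog 0 = ∞ := by simp [negLog, logAbs_zero]

theorem negLog_of_ne_zero {z : ℂ} (hz : z ≠ 0) : negLog z = ENNReal.ofReal (-Real.log ‖z‖) := by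
  rw [negLog, logAbs_of_ne_zero hz, ← EReal.coe_neg, EReal.real_coe_toENNReal]

theorem measurable_negLog : Measurable negLog := by
  have : Measurable logAbs := ENNReal.measurable_log.comp measurable_enorm
  exact this.neg.ereal_toENNReal

theorem logAbs_eq_sub (z : ℂ) :
    logAbs z = (ENNReal.ofReal (posLog ‖z‖) : EReal) - (negLog z : EReal) := by
  rcases eq_or_ne z 0 with rfl | hz
  · simp [logAbs_zero, negLog_zero]
  · rw [negLog_of_ne_zero hz, logAbs_of_ne_zero hz, EReal.coe_ennreal_ofReal,
      EReal.coe_ennreal_ofReal, ← EReal.coe_sub, posLog_apply]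
    congr 1
    rcases le_total (Real.log ‖z‖) 0 with h | h
    · rw [max_eq_left h, max_self, max_eq_left (by linarith)]; ring
    · rw [max_eq_right h, max_eq_left h, max_eq_right (by linarith)]; ring

/-- Truncating `log |z|` from below at `-K`. -/
theorem ofReal_posLog_exp_mul_add_min (z : ℂ) (K : ℕ) :
    ENNReal.ofReal (posLog ‖(Real.exp K : ℂ) * z‖) + min (negLog z) K =
      ENNReal.ofReal (posLog ‖z‖) + K := by
  rcases eq_or_ne z 0 with rfl | hz
  · simp [negLog_zero]
  · have hK : (K : ℝ≥0∞) = ENNReal.ofReal K := (ENNReal.ofReal_natCast K).symm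
    have hn : ‖(Real.exp K : ℂ) * z‖ = Real.exp K * ‖z‖ := by
      rw [norm_mul, Complex.norm_real, Real.norm_eq_abs, abs_of_pos (Real.exp_pos _)]
    have h0 : (0 : ℝ) ≤ K := K.cast_nonneg
    rw [hn, negLog_of_ne_zero hz, posLog_apply, posLog_apply,
      Real.log_mul (Real.exp_pos _).ne' (norm_ne_zero_iff.2 hz), Real.log_exp, hK]
    rcases le_total 0 (Real.log ‖z‖) with h | h
    · rw [ENNReal.ofReal_of_nonpos (by linarith : -Real.log ‖z‖ ≤ 0), min_eq_left zero_le, add_zero,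
        max_eq_right h, max_eq_right (by linarith), add_comm (K : ℝ), ENNReal.ofReal_add h h0]
    · rw [max_eq_left h, ENNReal.ofReal_zero, zero_add]
      rcases le_total (-Real.log ‖z‖) K with h' | h'
      · rw [min_eq_left (ENNReal.ofReal_le_ofReal h'), max_eq_right (by linarith),
          ← ENNReal.ofReal_add (by linarith) (by linarith)]
        congr 1
        ring
      · rw [min_eq_right (ENNReal.ofReal_le_ofReal h'), max_eq_left (by linarith),
          ENNReal.ofReal_zero, zero_add]

end LogAbs

/-- If `q = ∞` the left side is `-∞`; otherwise the hypothesis forces all four quantities to be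
finite. Estimates can thus be made additively, without subtracting infinities. -/
theorem coe_ennreal_sub_le_sub {p q a b : ℝ≥0∞} (ha : a ≠ ∞) (h : p + b ≤ a + q) :
    (p : EReal) - q ≤ (a : EReal) - b := by
  rcases eq_or_ne q ∞ with rfl | hq
  · rw [EReal.coe_ennreal_top, EReal.sub_top]
    exact bot_le
  have hpb : p + b ≠ ∞ := ne_top_of_le_ne_top (ENNReal.add_ne_top.2 ⟨ha, hq⟩) h
  obtain ⟨hp, hb⟩ := ENNReal.add_ne_top.1 hpb
  lift p to NNReal using hp
  lift q to NNReal using hq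
  lift a to NNReal using ha
  lift b to NNReal using hb
  have h' : (p : ℝ) + b ≤ a + q := by exact_mod_cast h
  have : (p : ℝ) - q ≤ a - b := by linarith
  simp only [EReal.coe_nnreal_eq_coe_real]
  exact_mod_cast this

theorem toENNReal_poisson_mul {ζ : Ell1} (hζ : ζ ∈ D1) (w : Torus) (x : EReal) :
    ((poisson ζ w : EReal) * x).toENNReal = ENNReal.ofReal (poisson ζ w) * x.toENNReal := by
  rw [EReal.toENNReal_mul (by exact_mod_cast poisson_nonneg hζ w), EReal.real_coe_toENNReal]

theorem eintegral_poisson_mul_logAbs {ζ : Ell1} (hζ : ζ ∈ D1) (f : Torus → ℂ) :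
    eintegral mInf (fun w => (poisson ζ w : EReal) * logAbs (f w)) =
      ((∫⁻ w, ENNReal.ofReal (poisson ζ w) * ENNReal.ofReal (posLog ‖f w‖) ∂mInf : ℝ≥0∞) : EReal) -
        ((∫⁻ w, ENNReal.ofReal (poisson ζ w) * negLog (f w) ∂mInf : ℝ≥0∞) : EReal) := by
  simp_rw [eintegral, ← mul_neg, toENNReal_poisson_mul hζ, toENNReal_logAbs, negLog]

variable {F : Ell1 → ℂ}

theorem Nevanlinna.ae_tendsto_radialLimit (hF : Nevanlinna F) :
    ∀ᵐ w ∂mInf, Tendsto (fun r : ℝ => slice F r w) (𝓝[<] (1 : ℝ)) (𝓝 (radialLimit F w)) := by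
  filter_upwards [hF.ae_exists_limit] with w hw using tendsto_nhds_limUnder hw

theorem Nevanlinna.aemeasurable_radialLimit (hF : Nevanlinna F) :
    AEMeasurable (radialLimit F) mInf := by
  obtain ⟨u, hu, -, hut⟩ := exists_seq_Ioo_tendsto_one
  refine aemeasurable_of_tendsto_metrizable_ae atTop (f := fun n => slice F (u n))
    (fun n => (continuous_slice hF.1 (hu n)).measurable.aemeasurable) ?_
  filter_upwards [hF.ae_tendsto_radialLimit] with w hw using hw.comp hut

theorem Nevanlinna.lintegral_posLog_radialLimit_lt_top (hF : Nevanlinna F) :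
    ∫⁻ w, ENNReal.ofReal (posLog ‖radialLimit F w‖) ∂mInf < ∞ := by
  obtain ⟨u, hu, -, hut⟩ := exists_seq_Ioo_tendsto_one
  calc ∫⁻ w, ENNReal.ofReal (posLog ‖radialLimit F w‖) ∂mInf
      = ∫⁻ w, liminf (fun n => ENNReal.ofReal (posLog ‖slice F (u n) w‖)) atTop ∂mInf := by
        refine lintegral_congr_ae ?_
        filter_upwards [hF.ae_tendsto_radialLimit] with w hw
        exact (ENNReal.tendsto_ofReal
          ((continuous_posLog.tendsto _).comp (hw.comp hut).norm)).liminf_eq.symm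
    _ ≤ liminf (fun n => ∫⁻ w, ENNReal.ofReal (posLog ‖slice F (u n) w‖) ∂mInf) atTop :=
        lintegral_liminf_le fun n => measurable_posLog_slice hF.1 (hu n)
    _ ≤ ⨆ r ∈ Ioo (0 : ℝ) 1, ∫⁻ w, ENNReal.ofReal (posLog ‖slice F r w‖) ∂mInf :=
        liminf_le_of_frequently_le' (.of_forall fun n =>
          le_iSup₂ (f := fun r (_ : r ∈ Ioo (0 : ℝ) 1) =>
            ∫⁻ w, ENNReal.ofReal (posLog ‖slice F r w‖) ∂mInf) (u n) (hu n))
    _ < ∞ := hF.2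

theorem eLpNorm_posLog_norm (f : Torus → ℂ) :
    eLpNorm (fun w => posLog ‖f w‖) 1 mInf = ∫⁻ w, ENNReal.ofReal (posLog ‖f w‖) ∂mInf := by
  rw [eLpNorm_one_eq_lintegral_enorm]
  exact lintegral_congr fun w => Real.enorm_of_nonneg posLog_nonneg

theorem Nevanlinna.memLp_posLog_radialLimit (hF : Nevanlinna F) :
    MemLp (fun w => posLog ‖radialLimit F w‖) 1 mInf := by
  refine ⟨(continuous_posLog.measurable.comp_aemeasurable
    hF.aemeasurable_radialLimit.norm).aestronglyMeasurable, ?_⟩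
  rw [eLpNorm_posLog_norm]
  exact hF.lintegral_posLog_radialLimit_lt_top

theorem IsHolomorphicOn.const_mul {X : Type*} [NormedAddCommGroup X] [NormedSpace ℂ X]
    {f : X → ℂ} {V : Set X} (hf : IsHolomorphicOn f V) (c : ℂ) :
    IsHolomorphicOn (fun x => c * f x) V := by
  refine ⟨fun x hx => ?_, fun x₀ hx₀ x => (hf.2 x₀ hx₀ x).const_mul c⟩
  obtain ⟨U, hU, C, hC⟩ := hf.1 x hx
  refine ⟨U, hU, ‖c‖ * C, fun y hy => ?_⟩
  rw [norm_mul]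
  exact mul_le_mul_of_nonneg_left (hC y hy) (norm_nonneg c)

theorem posLog_norm_mul_le (c z : ℂ) : posLog ‖c * z‖ ≤ posLog ‖c‖ + posLog ‖z‖ := by
  rw [norm_mul]
  exact posLog_mul

theorem Nevanlinna.const_mul (hF : Nevanlinna F) (c : ℂ) : Nevanlinna fun ζ => c * F ζ := by
  refine ⟨hF.1.const_mul c, ?_⟩
  refine lt_of_le_of_lt (iSup₂_le fun r hr => ?_)
    (ENNReal.add_lt_top.2 ⟨ENNReal.ofReal_lt_top (r := posLog ‖c‖), hF.2⟩)
  calc ∫⁻ w, ENNReal.ofReal (posLog ‖slice (fun ζ => c * F ζ) r w‖) ∂mInf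
      ≤ ∫⁻ w, (ENNReal.ofReal (posLog ‖c‖) + ENNReal.ofReal (posLog ‖slice F r w‖)) ∂mInf := by
        refine lintegral_mono fun w => ?_
        rw [← ENNReal.ofReal_add posLog_nonneg posLog_nonneg]
        exact ENNReal.ofReal_le_ofReal (posLog_norm_mul_le c _)
    _ = ENNReal.ofReal (posLog ‖c‖) + ∫⁻ w, ENNReal.ofReal (posLog ‖slice F r w‖) ∂mInf := by
        rw [lintegral_add_left measurable_const]
        simp
    _ ≤ _ := by
        gcongr
        exact le_iSup₂ (f := fun r (_ : r ∈ Ioo (0 : ℝ) 1) =>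
          ∫⁻ w, ENNReal.ofReal (posLog ‖slice F r w‖) ∂mInf) r hr

/-- Needed for the constants `e^K`, which convert estimates for `log⁺` into estimates for truncated
logarithms. -/
theorem Smirnov.const_mul (hF : Smirnov F) (c : ℂ) : Smirnov fun ζ => c * F ζ := by
  obtain ⟨hN, hm, hui, C, hC⟩ := hF
  have hcN := hN.const_mul c
  have hm' : ∀ r : Ioo (0 : ℝ) 1,
      AEStronglyMeasurable (fun w => posLog ‖slice (fun ζ => c * F ζ) r w‖) mInf := fun r =>
    (continuous_posLog_slice hcN.1 r.2).aestronglyMeasurable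
  have hle : ∀ (r : Ioo (0 : ℝ) 1) w, ‖posLog ‖slice (fun ζ => c * F ζ) r w‖‖ ≤
      ‖posLog ‖c‖ + posLog ‖slice F r w‖‖ := fun r w => by
    rw [Real.norm_of_nonneg posLog_nonneg, Real.norm_of_nonneg (add_nonneg posLog_nonneg posLog_nonneg)]
    exact posLog_norm_mul_le c _
  have hcm : MemLp (fun _ : Torus => posLog ‖c‖) 1 mInf := memLp_const _
  refine ⟨hcN, hm', ?_, (eLpNorm (fun _ : Torus => posLog ‖c‖) 1 mInf).toNNReal + C, fun r => ?_⟩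
  · intro ε hε
    obtain ⟨δ, hδ, h⟩ := ((unifIntegrable_const le_rfl ENNReal.one_ne_top hcm).add hui le_rfl
      (fun _ => hcm.1) hm) hε
    refine ⟨δ, hδ, fun r s hs hsδ => (eLpNorm_mono fun w => ?_).trans (h r s hs hsδ)⟩
    by_cases hw : w ∈ s
    · rw [indicator_of_mem hw, indicator_of_mem hw]
      exact hle r w
    · simp only [indicator_of_notMem hw, le_refl]
  · rw [ENNReal.coe_add, ENNReal.coe_toNNReal hcm.2.ne]
    exact (eLpNorm_mono (hle r)).trans ((eLpNorm_add_le hcm.1 (hm r) le_rfl).trans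
      (add_le_add_right (hC r) _))

theorem Nevanlinna.radialLimit_const_mul (hF : Nevanlinna F) (c : ℂ) :
    ∀ᵐ w ∂mInf, radialLimit (fun ζ => c * F ζ) w = c * radialLimit F w := by
  filter_upwards [hF.ae_tendsto_radialLimit] with w hw
  exact (hw.const_mul c).limUnder_eq

/-- For functions of the Smirnov class, `log⁺ |F|` is dominated by the Poisson integral of its
boundary values. -/
theorem Smirnov.posLog_le_lintegral_poisson (hF : Smirnov F) {ζ : Ell1} (hζ : ζ ∈ D1) :
    ENNReal.ofReal (posLog ‖F ζ‖) ≤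
      ∫⁻ w, ENNReal.ofReal (poisson ζ w) * ENNReal.ofReal (posLog ‖radialLimit F w‖) ∂mInf := by
  obtain ⟨hN, hm, hui, -⟩ := hF
  obtain ⟨u, hu, hu1, hut⟩ := exists_seq_Ioo_tendsto_one
  obtain ⟨B, hB⟩ := exists_poisson_le hζ
  have hL : Tendsto (fun n => ENNReal.ofReal
      (posLog ‖F (ofSeq fun k => (u n : ℂ) ^ (k + 1) * ζ k)‖)) atTop
      (𝓝 (ENNReal.ofReal (posLog ‖F ζ‖))) := by
    have h1 : Tendsto (fun n => ofSeq fun k => (u n : ℂ) ^ (k + 1) * ζ k) atTop (𝓝 ζ) := by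
      nth_rewrite 2 [← ofSeq_coe ζ]
      refine tendsto_ofSeq (summable_norm_ell1 ζ) (fun k => ?_) fun n k => ?_
      · have : Tendsto (fun n => (u n : ℂ) ^ (k + 1) * ζ k) atTop (𝓝 (((1 : ℝ) : ℂ) ^ (k + 1) * ζ k)) :=
          (((Complex.continuous_ofReal.tendsto 1).comp hu1).pow (k + 1)).mul_const _
        simpa using this
      · rw [norm_mul, norm_pow, Complex.norm_real, Real.norm_of_nonneg (hu n).1.le]
        exact mul_le_of_le_one_left (norm_nonneg _) (pow_le_one₀ (hu n).1.le (hu n).2.le)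
    have h2 := (hN.1.differentiableAt isOpen_D1 hζ).continuousAt.tendsto.comp h1
    exact ENNReal.tendsto_ofReal ((continuous_posLog.tendsto _).comp h2.norm)
  have hui' : UnifIntegrable (fun n w => posLog ‖slice F (u n) w‖) 1 mInf := fun ε hε => by
    obtain ⟨δ, hδ, h⟩ := hui hε
    exact ⟨δ, hδ, fun n => h ⟨u n, hu n⟩⟩
  -- Vitali's theorem: this is where uniform integrability enters.
  have hlim := tendsto_Lp_finite_of_tendsto_ae le_rfl ENNReal.one_ne_top
    (fun n => hm ⟨u n, hu n⟩) hN.memLp_posLog_radialLimit hui' (by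
      filter_upwards [hN.ae_tendsto_radialLimit] with w hw
      exact (continuous_posLog.tendsto _).comp (hw.comp hut).norm)
  set A := ∫⁻ w, ENNReal.ofReal (poisson ζ w) * ENNReal.ofReal (posLog ‖radialLimit F w‖) ∂mInf
  have hR : Tendsto (fun n => A + ENNReal.ofReal B *
      eLpNorm ((fun w => posLog ‖slice F (u n) w‖) - fun w => posLog ‖radialLimit F w‖) 1 mInf)
      atTop (𝓝 A) := by
    have := (ENNReal.Tendsto.const_mul hlim (.inr (ENNReal.ofReal_ne_top (r := B)))).const_add A
    simpa using this
  refine le_of_tendsto_of_tendsto' hL hR fun n => ?_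
  refine (InfPolydisc.posLog_le_lintegral_poisson hN.1 hζ (hu n)).trans ?_
  have hmR : AEMeasurable (fun w => ENNReal.ofReal (poisson ζ w) *
      ENNReal.ofReal (posLog ‖radialLimit F w‖)) mInf :=
    (measurable_poisson hζ).ennreal_ofReal.aemeasurable.mul
      hN.memLp_posLog_radialLimit.1.aemeasurable.ennreal_ofReal
  rw [eLpNorm_one_eq_lintegral_enorm, ← lintegral_const_mul' _ _ ENNReal.ofReal_ne_top,
    ← lintegral_add_left' hmR]
  refine lintegral_mono fun w => ?_
  rw [Pi.sub_apply, Real.enorm_eq_ofReal_abs]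
  have h1 : ENNReal.ofReal (posLog ‖slice F (u n) w‖) ≤ ENNReal.ofReal (posLog ‖radialLimit F w‖) +
      ENNReal.ofReal |posLog ‖slice F (u n) w‖ - posLog ‖radialLimit F w‖| := by
    rw [← ENNReal.ofReal_add posLog_nonneg (abs_nonneg _)]
    refine ENNReal.ofReal_le_ofReal ?_
    linarith [le_abs_self (posLog ‖slice F (u n) w‖ - posLog ‖radialLimit F w‖)]
  calc _ ≤ ENNReal.ofReal (poisson ζ w) * (ENNReal.ofReal (posLog ‖radialLimit F w‖) +
      ENNReal.ofReal |posLog ‖slice F (u n) w‖ - posLog ‖radialLimit F w‖|) := by gcongr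
    _ ≤ _ := by
      rw [mul_add]
      gcongr
      exact hB w

/-- The majorant for `log⁺ |e^K F|`, minus `K`, bounds `max (log |F ζ|) (-K)` by the Poisson
integral of the boundary logarithm truncated at `-K`; then `K → ∞`. -/
theorem Smirnov.logAbs_le (hF : Smirnov F) {ζ : Ell1} (hζ : ζ ∈ D1) :
    logAbs (F ζ) ≤
      eintegral mInf (fun w => (poisson ζ w : EReal) * logAbs (radialLimit F w)) := by
  have hN := hF.1
  have hPm := (measurable_poisson hζ).ennreal_ofReal.aemeasurable (μ := mInf)
  have hRm := hN.aemeasurable_radialLimit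
  rw [eintegral_poisson_mul_logAbs hζ, logAbs_eq_sub]
  set a := ∫⁻ w, ENNReal.ofReal (poisson ζ w) * ENNReal.ofReal (posLog ‖radialLimit F w‖) ∂mInf
    with ha
  have hafin : a ≠ ∞ := by
    obtain ⟨B, hB⟩ := exists_poisson_le hζ
    have : a ≤ ENNReal.ofReal B * ∫⁻ w, ENNReal.ofReal (posLog ‖radialLimit F w‖) ∂mInf := by
      rw [← lintegral_const_mul' _ _ ENNReal.ofReal_ne_top]
      refine lintegral_mono fun w => ?_
      gcongr
      exact hB w
    exact ne_top_of_le_ne_top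
      (ENNReal.mul_ne_top ENNReal.ofReal_ne_top hN.lintegral_posLog_radialLimit_lt_top.ne) this
  have hmin : ∀ K : ℕ, AEMeasurable (fun w => ENNReal.ofReal (poisson ζ w) *
      min (negLog (radialLimit F w)) K) mInf := fun K =>
    hPm.mul ((measurable_negLog.comp_aemeasurable hRm).min aemeasurable_const)
  -- The truncated inequality with negative parts moved across, so that every term is nonnegative.
  -- The Poisson measure has mass 1, so the constant `K` cancels.
  have hK : ∀ K : ℕ, ENNReal.ofReal (posLog ‖F ζ‖) +
      ∫⁻ w, ENNReal.ofReal (poisson ζ w) * min (negLog (radialLimit F w)) K ∂mInf ≤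
        a + negLog (F ζ) := by
    intro K
    have h1 := (hF.const_mul (Real.exp K : ℂ)).posLog_le_lintegral_poisson hζ
    set b := ∫⁻ w, ENNReal.ofReal (poisson ζ w) * min (negLog (radialLimit F w)) K ∂mInf
    have h2 : (∫⁻ w, ENNReal.ofReal (poisson ζ w) * ENNReal.ofReal
        (posLog ‖radialLimit (fun ζ => (Real.exp K : ℂ) * F ζ) w‖) ∂mInf) + b = a + K := by
      have hone : ∫⁻ w, ENNReal.ofReal (poisson ζ w) * (K : ℝ≥0∞) ∂mInf = K := by
        rw [lintegral_mul_const' _ _ (ENNReal.natCast_ne_top K), lintegral_poisson hζ, one_mul]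
      rw [← lintegral_add_right' _ (hmin K)]
      nth_rewrite 2 [← hone]
      rw [ha, ← lintegral_add_right' _ (hPm.mul_const _)]
      refine lintegral_congr_ae ?_
      filter_upwards [hN.radialLimit_const_mul (Real.exp K : ℂ)] with w hw
      rw [hw, ← mul_add, ← mul_add, ofReal_posLog_exp_mul_add_min]
    have h3 := ofReal_posLog_exp_mul_add_min (F ζ) K
    have h4 : (ENNReal.ofReal (posLog ‖F ζ‖) + b) + K ≤ (a + negLog (F ζ)) + K := by
      calc (ENNReal.ofReal (posLog ‖F ζ‖) + b) + K
          = (ENNReal.ofReal (posLog ‖(Real.exp K : ℂ) * F ζ‖) + b) + min (negLog (F ζ)) K := by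
            rw [add_right_comm, ← h3, add_right_comm]
        _ ≤ (a + K) + negLog (F ζ) := by
            rw [← h2]
            gcongr
            exact min_le_left _ _
        _ = _ := add_right_comm _ _ _
    exact (ENNReal.add_le_add_iff_right (ENNReal.natCast_ne_top K)).1 h4
  refine coe_ennreal_sub_le_sub hafin ?_
  -- Monotone convergence also covers an infinite integral of the negative part.
  have hlim : Tendsto (fun K : ℕ => ∫⁻ w, ENNReal.ofReal (poisson ζ w) *
      min (negLog (radialLimit F w)) K ∂mInf) atTop
      (𝓝 (∫⁻ w, ENNReal.ofReal (poisson ζ w) * negLog (radialLimit F w) ∂mInf)) := by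
    refine lintegral_tendsto_of_tendsto_of_monotone hmin (.of_forall fun w K L hKL => ?_)
      (.of_forall fun w => ?_)
    · dsimp only
      gcongr
    · refine ENNReal.Tendsto.const_mul ?_ (.inr ENNReal.ofReal_ne_top)
      have := (tendsto_const_nhds (x := negLog (radialLimit F w))).min ENNReal.tendsto_nat_nhds_top
      simpa using this
  exact le_of_tendsto' (hlim.const_add _) hK

theorem Nevanlinna.smirnov_of_logAbs_le (hF : Nevanlinna F)
    (h : ∀ ζ ∈ D1, logAbs (F ζ) ≤
      eintegral mInf (fun w => (poisson ζ w : EReal) * logAbs (radialLimit F w))) :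
    Smirnov F := by
  have hgm : AEMeasurable (fun w => ENNReal.ofReal (posLog ‖radialLimit F w‖)) mInf :=
    hF.memLp_posLog_radialLimit.1.aemeasurable.ennreal_ofReal
  set g := hgm.mk
  -- A measurable representative is fixed because it will be translated and used in Fubini's
  -- theorem.
  have hgM : Measurable g := hgm.measurable_mk
  have hgfin : ∫⁻ w, g w ∂mInf ≠ ∞ := by
    rw [← lintegral_congr_ae hgm.ae_eq_mk]
    exact hF.lintegral_posLog_radialLimit_lt_top.ne
  have hpt : ∀ ζ ∈ D1, ENNReal.ofReal (posLog ‖F ζ‖) ≤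
      ∫⁻ w, ENNReal.ofReal (poisson ζ w) * g w ∂mInf := by
    intro ζ hζ
    have h1 := h ζ hζ
    rw [eintegral_poisson_mul_logAbs hζ] at h1
    have h2 := EReal.toENNReal_le_toENNReal (h1.trans
      (EReal.sub_le_sub le_rfl (EReal.coe_ennreal_nonneg _)))
    rw [toENNReal_logAbs, sub_zero, EReal.toENNReal_coe] at h2
    refine h2.trans_eq (lintegral_congr_ae ?_)
    filter_upwards [hgm.ae_eq_mk] with w hw
    rw [hw]
  -- A bound for the integral of `g` that is uniform over all translates of `s` passes to `log⁺
  -- |F_[r]|` on `s`, because the averaging kernel has mass 1.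
  have hset : ∀ r ∈ Ioo (0 : ℝ) 1, ∀ s, MeasurableSet s → ∀ ε : ℝ≥0∞,
      (∀ v : Torus, ∫⁻ w in (fun x => v⁻¹ * x) ⁻¹' s, g w ∂mInf ≤ ε) →
      ∫⁻ w in s, ENNReal.ofReal (posLog ‖slice F r w‖) ∂mInf ≤ ε := by
    intro r hr s hs ε hε
    have hr' : |r| < 1 := by rw [abs_of_pos hr.1]; exact hr.2
    have h1 : ∀ w, ENNReal.ofReal (posLog ‖slice F r w‖) ≤
        ∫⁻ v, ENNReal.ofReal (poisson (dilate r 1) v) * g (v * w) ∂mInf := by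
      intro w
      refine (hpt _ (dilate_mem_D1 hr' w)).trans_eq ?_
      rw [← lintegral_mul_left_eq_self (μ := mInf)
        (fun v => ENNReal.ofReal (poisson (dilate r w) v) * g v) w]
      refine lintegral_congr fun v => ?_
      rw [mul_comm w v, poisson_dilate_mul hr']
    have hPm := (measurable_poisson (dilate_mem_D1 hr' 1)).ennreal_ofReal
    calc ∫⁻ w in s, ENNReal.ofReal (posLog ‖slice F r w‖) ∂mInf
        ≤ ∫⁻ w in s, ∫⁻ v, ENNReal.ofReal (poisson (dilate r 1) v) * g (v * w) ∂mInf ∂mInf :=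
          lintegral_mono h1
      _ = ∫⁻ v, ∫⁻ w in s, ENNReal.ofReal (poisson (dilate r 1) v) * g (v * w) ∂mInf ∂mInf := by
          refine lintegral_lintegral_swap (Measurable.aemeasurable ?_)
          exact (hPm.comp measurable_snd).mul
            (hgM.comp (Continuous.measurable (by fun_prop)))
      _ ≤ ∫⁻ v, ENNReal.ofReal (poisson (dilate r 1) v) * ε ∂mInf := by
          refine lintegral_mono fun v => ?_
          rw [lintegral_const_mul' _ _ ENNReal.ofReal_ne_top]
          gcongr
          refine le_trans (le_of_eq ?_) (hε v)
          have hs' : MeasurableSet ((fun x : Torus => v⁻¹ * x) ⁻¹' s) :=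
            (continuous_const_mul v⁻¹).measurable hs
          rw [← lintegral_indicator hs, ← lintegral_indicator hs',
            ← lintegral_mul_left_eq_self (μ := mInf) (((fun x : Torus => v⁻¹ * x) ⁻¹' s).indicator g) v]
          refine lintegral_congr fun w => ?_
          by_cases hw : w ∈ s
          · rw [indicator_of_mem hw, indicator_of_mem (by simpa using hw)]
          · rw [indicator_of_notMem hw, indicator_of_notMem (by simpa using hw)]
      _ = ε := by
          rw [lintegral_mul_const _ hPm, lintegral_poisson (dilate_mem_D1 hr' 1), one_mul]
  refine ⟨hF, fun r => (continuous_posLog_slice hF.1 r.2).aestronglyMeasurable, ?_,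
    (⨆ r ∈ Ioo (0 : ℝ) 1, ∫⁻ w, ENNReal.ofReal (posLog ‖slice F r w‖) ∂mInf).toNNReal,
    fun r => ?_⟩
  · intro ε hε
    -- Absolute continuity of the integral of `g` alone: translates of `s` have the same Haar
    -- measure, so one `δ` serves all of them and every `r`.
    obtain ⟨δ, hδ, hδs⟩ := exists_pos_setLIntegral_lt_of_measure_lt hgfin
      (ENNReal.ofReal_pos.2 hε).ne'
    obtain ⟨δ', -, hδ'0, hδ'⟩ := ENNReal.lt_iff_exists_real_btwn.1 hδ
    refine ⟨δ', ENNReal.ofReal_pos.1 hδ'0, fun r s hs hsδ => ?_⟩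
    have hind : s.indicator (fun w => posLog ‖slice F r w‖) =
        fun w => posLog ‖s.indicator (slice F r) w‖ := by
      ext w
      by_cases hw : w ∈ s <;> simp [hw]
    rw [hind, eLpNorm_posLog_norm]
    have hind' : (fun w => ENNReal.ofReal (posLog ‖s.indicator (slice F r) w‖)) =
        s.indicator fun w => ENNReal.ofReal (posLog ‖slice F r w‖) := by
      ext w
      by_cases hw : w ∈ s <;> simp [hw]
    rw [hind', lintegral_indicator hs]
    refine hset r r.2 s hs _ fun v => (hδs _ ?_).le
    rw [measure_preimage_mul]
    exact hsδ.trans_lt hδ'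
  · rw [ENNReal.coe_toNNReal hF.2.ne, eLpNorm_posLog_norm]
    exact le_iSup₂ (f := fun r (_ : r ∈ Ioo (0 : ℝ) 1) =>
      ∫⁻ w, ENNReal.ofReal (posLog ‖slice F r w‖) ∂mInf) r.1 r.2

end InfPolydisc

theorem proposition2p14 (F : InfPolydisc.Ell1 → ℂ) (hF : InfPolydisc.Nevanlinna F) :
    (∀ᵐ w ∂InfPolydisc.mInf, ∃ l : ℂ,
      Tendsto (fun r : ℝ => InfPolydisc.slice F r w) (𝓝[<] (1 : ℝ)) (𝓝 l)) ∧
    (InfPolydisc.Smirnov F ↔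
      ∀ ζ ∈ InfPolydisc.D1,
        InfPolydisc.logAbs (F ζ) ≤
          InfPolydisc.eintegral InfPolydisc.mInf (fun w =>
            (InfPolydisc.poisson ζ w : EReal) *
              InfPolydisc.logAbs (InfPolydisc.radialLimit F w))) :=
  ⟨hF.ae_exists_limit, fun hS _ hζ => hS.logAbs_le hζ, hF.smirnov_of_logAbs_le⟩
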